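/- Let $G_1,G_2$ be (Hausdorff) locally compact abelian groups with Haar measures $du$, $dv$, and let $1<p,q<\infty$. For measurable $f:G_1\times G_2\to\mathbb C$ and $D=D_1\times D_2\subset G_1\times G_2$ put $$\|f\|_{L^{p,q}(D)}=\Big(\int_{D_1}\Big(\int_{D_2}|f(u,v)|^q\,dv\Big)^{p/q}du\Big)^{1/p},\qquad \|c\|_{\ell^{p,q}}=\Big(\sum_s\Big(\sum_t|c(s,t)|^q\Big)^{p/q}\Big)^{1/p},$$ and $\|\mathbf c\|_{\ell^{p,q}}=\sum_{i=1}^r\|c_i\|_{\ell^{p,q}}$ for $\mathbf c=(c_1,\dots,c_r)^T\in(\ell^{p,q})^r$. Let $I$ be countable and let $\{x_s\}_{s\in I}\subset G_1$, $\{y_t\}_{t\in I}\subset G_2$ be separated, i.e. there are neighbourhoods $U_1,U_2$ of the identities such that the sets $x_s+U_1$ are pairwise disjoint and the sets $y_t+U_2$ are pairwise disjoint. Assume: (A1) $\omega\in L^1(G_1\times G_2)$ has support in $W=W_1\times W_2$, where $W_1\subset G_1$, $W_2\subset G_2$ are compact and contain the identities. (A2) $K=K_1\times K_2$ with $K_1\subset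 G_1$, $K_2\subset G_2$ compact of Haar measures $\mu_1,\mu_2$; $\widetilde K=K-W=(K_1-W_1)\times(K_2-W_2)$; $\Phi=(\phi_1,\dots,\phi_r)^T$ with $\phi_i$ continuous and compactly supported on $G_1\times G_2$; and there are $0<a_1\le a_2<\infty$ with $$a_1\|\mathbf c\|_{\ell^{p,q}}\le\Big\|\sum_{s,t}\mathbf c(s,t)^T\Phi(\cdot-x_s,\cdot-y_t)\Big\|_{L^{p,q}(\widetilde K)}\le a_2\|\mathbf c\|_{\ell^{p,q}}$$ for all $\mathbf c\in(\ell^{p,q})^r$ such that $\mathbf c(s,t)=0$ whenever $\Phi(\cdot-x_s,\cdot-y_t)\equiv0$ on $\widetilde K$. (A3) $\widetilde K-\Omega$ is sequentially compact, where $\Omega=\bigcup_{i=1}^r\operatorname{supp}\phi_i$. (A4) $\rho$ is a probability density on $K$ (with respect to $du\,dv$) with $0<\mathcal C_{\rho,1}\le\rho(u,v)\le\mathcal C_{\rho,2}$ for all $(u,v)\in K$. Let $V_K(\Phi)$ be the set of $f\in L^{p,q}(G_1\times G_2)$ for which there is $\mathbf c\in(\ell^{p,q})^r$ with $f=\sum_{s,t}\mathbf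 c(s,t)^T\Phi(\cdot-x_s,\cdot-y_t)$ a.e. on $\widetilde K$, let $d$ be its dimension as a real vector space when it is regarded as a space of (a.e. classes of) functions on $\widetilde K$, and let $$\widetilde C_\Phi=\sup_{(u,v)\in\widetilde K}\sum_{i=1}^r\sum_{s,t}|\phi_i(u-x_s,v-y_t)| .$$ For $\theta,\alpha>0$ put $$V^{p,q}_{K,\alpha}(\Phi,\theta)=\{f\in V_K(\Phi):\ \|f*\omega\|_{L^{p,q}(K)}\ge\theta,\ \|f\|_{L^{p,q}(\widetilde K)}\le\alpha\}.$$ Let $\{(u_j,v_k)\}_{j,k\in\mathbb N}$ be a doubly indexed family of i.i.d. random points (one random point of $K$ for each pair $(j,k)$) with density $\rho$. Write $\|\omega\|=\|\omega\|_{L^1(W)}$, let $\gamma\in(0,1)$, and for $\zeta>0$ let $$N_\zeta=\gamma\,\mathcal C_{\rho,1}\mu_1^{1-q}\mu_2^{1-p}\Big(\frac{\widetilde C_\Phi\|\omega\|}{a_1}\Big)^{1-pq}\zeta^{pq},\qquad T_\zeta=\gamma\,\mathcal C_{\rho,1}\Big(\frac{a_1\zeta}{\widetilde C_\Phi\|\omega\|}\Big)^{pq},$$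 $$\widetilde A_{\zeta,\gamma}=(1-\gamma)\,\mathcal C_{\rho,1}\mu_1^{1-q}\mu_2^{1-p}\Big(\frac{\widetilde C_\Phi\|\omega\|}{a_1}\Big)^{1-pq}\zeta^{pq}\,n^{1/p}m^{1/q},$$ $$\widetilde B_{\zeta,\gamma}=\mathcal C_{\rho,2}\,\mu_1^{\frac{p-1}p}\mu_2^{\frac{q-1}q}\|\omega\|\,nm+N_\zeta\,nm,$$ $$\beta'_{\zeta,\gamma}=\frac{\mu_1^{1-q}\mu_2^{1-p}\big(\frac{\sqrt3}2T_\zeta\big)^2}{6\mu_1^{q-1}\mu_2^{p-1}+T_\zeta},\qquad \beta''_{\zeta,\gamma}=\frac{\mu_1^{1-q}\mu_2^{1-p}\big(T_\zeta\frac{\widetilde C_\Phi}{a_1}\big)^2}{72\sqrt2\,\big(81\mu_1^{q-1}\mu_2^{p-1}+T_\zeta\frac{\widetilde C_\Phi}{a_1}\big)},$$ $$\mathcal A_1=2\exp\Big(d\ln\frac{8\widetilde C_\Phi}{a_1}\Big),\qquad \mathcal A_2=\frac4{3d(\ln2)^2}\Big(\frac{4\widetilde C_\Phi}{a_1}\Big)^{2d}.$$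 (If $d=0$, $\widetilde C_\Phi=0$ or $\|\omega\|=0$, then $V^{p,q}_{K,\alpha}(\Phi,\theta)$ is empty and there is nothing to prove.) If $n,m\in\mathbb N$ satisfy $$nm>\frac{108\sqrt2\,(\ln2)\,d\,\|\omega\|}{N_{\theta/\alpha}^{2}}\,\big(162\|\omega\|+2N_{\theta/\alpha}\big),$$ then with probability at least $1-\mathcal A_1e^{-nm\beta'_{\theta/\alpha,\gamma}}-\mathcal A_2e^{-nm\beta''_{\theta/\alpha,\gamma}}$ the inequality $$\widetilde A_{\frac\theta\alpha,\gamma}\|f\|_{L^{p,q}(\widetilde K)}\le\Big\|\{(f*\omega)(u_j,v_k)\}_{1\le j\le n,\,1\le k\le m}\Big\|_{\ell^{p,q}}\le\widetilde B_{\frac\theta\alpha,\gamma}\|f\|_{L^{p,q}(\widetilde K)}$$ holds for all $f\in V^{p,q}_{K,\alpha}(\Phi,\theta)$ simultaneously. -/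

import Mathlib

open MeasureTheory ProbabilityTheory Topology
open scoped ENNReal Pointwise

namespace RandomAverageSampling

noncomputable section

/-- The mixed norm `(∫ (∫ |f(u,v)|^q dν(v))^{p/q} dμ(u))^{1/p}`, as an extended non-negative number.
The norm over a rectangle `A × B` is obtained by restricting `μ` to `A` and `ν` to `B`. -/
def mixedNorm {X Y : Type*} [MeasurableSpace X] [MeasurableSpace Y] (p q : ℝ)
    (μ : Measure X) (ν : Measure Y) (f : X × Y → ℂ) : ℝ≥0∞ :=
  (∫⁻ u, (∫⁻ v, ‖f (u, v)‖ₑ ^ q ∂ν) ^ (p / q) ∂μ) ^ (1 / p)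

/-- The mixed sequence norm `(∑_s (∑_t |c(s,t)|^q)^{p/q})^{1/p}`, as an extended non-negative
number. -/
def seqNorm {I J : Type*} (p q : ℝ) (c : I → J → ℂ) : ℝ≥0∞ :=
  (∑' s, (∑' t, ‖c s t‖ₑ ^ q) ^ (p / q)) ^ (1 / p)

/-- The norm `∑_i ‖c_i‖` on `r`-tuples of sequences in `ℓ^{p,q}`. -/
def vecSeqNorm {I J : Type*} {r : ℕ} (p q : ℝ) (c : Fin r → I → J → ℂ) : ℝ≥0∞ :=
  ∑ i, seqNorm p q (c i)

/-- A family of group elements is separated if, for some neighbourhood `U` of the identity, the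
translates `x i + U` are pairwise disjoint. -/
def IsSeparatedFamily {G I : Type*} [AddGroup G] [TopologicalSpace G] (x : I → G) : Prop :=
  ∃ U ∈ 𝓝 (0 : G), Pairwise fun i j => Disjoint ((x i + ·) '' U) ((x j + ·) '' U)

section Measures

variable {G₁ G₂ : Type*} [MeasurableSpace G₁] [MeasurableSpace G₂]

/-- The product Haar measure on a rectangle `A × B`. It is written as the product of the two
restrictions so that it is meaningful for compact `A` and `B` in groups that are not
`σ`-compact. -/
def haarRect (μ₁ : Measure G₁) (μ₂ : Measure G₂) (A : Set G₁) (B : Set G₂) : Measure (G₁ × G₂) :=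
  (μ₁.restrict A).prod (μ₂.restrict B)

/-- The convolution `(f * ω)(u,v) = ∫∫ f(u - u', v - v') ω(u', v') dv' du'`. -/
def conv [Sub G₁] [Sub G₂] (μ₁ : Measure G₁) (μ₂ : Measure G₂) (f ω : G₁ × G₂ → ℂ)
    (z : G₁ × G₂) : ℂ :=
  ∫ u', ∫ v', f (z.1 - u', z.2 - v') * ω (u', v') ∂μ₂ ∂μ₁

end Measures

section Shifts

variable {G₁ G₂ I : Type*} [Sub G₁] [Sub G₂] {r : ℕ}

/-- The quasi shift sum `∑_{s,t} c(s,t)ᵀ Φ(u - x_s, v - y_t)`. For separated `x`, `y` and compactly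
supported `Φ` only finitely many terms are nonzero at each point. -/
def shiftSum (φ : Fin r → G₁ × G₂ → ℂ) (x : I → G₁) (y : I → G₂) (c : Fin r → I → I → ℂ)
    (z : G₁ × G₂) : ℂ :=
  ∑' st : I × I, ∑ i, c i st.1 st.2 * φ i (z.1 - x st.1, z.2 - y st.2)

/-- The supremum over `z = (u,v) ∈ D` of `∑_i ∑_{s,t} |φ_i(u - x_s, v - y_t)|`. -/
def supShiftSum (φ : Fin r → G₁ × G₂ → ℂ) (x : I → G₁) (y : I → G₂) (D : Set (G₁ × G₂)) : ℝ :=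
  ⨆ z : D, ∑ i, ∑' st : I × I, ‖φ i ((z : G₁ × G₂).1 - x st.1, (z : G₁ × G₂).2 - y st.2)‖

/-- `Φ` has stable shifts on the rectangle `D₁ × D₂` with bounds `a₁`, `a₂`. The inequality is asked
for those coefficients in `(ℓ^{p,q})^r` that vanish at each `(s,t)` for which
`Φ(· - x_s, · - y_t)` is identically zero on `D₁ × D₂`. -/
def HasStableShifts [MeasurableSpace G₁] [MeasurableSpace G₂] (p q : ℝ)
    (μ₁ : Measure G₁) (μ₂ : Measure G₂) (D₁ : Set G₁) (D₂ : Set G₂)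
    (φ : Fin r → G₁ × G₂ → ℂ) (x : I → G₁) (y : I → G₂) (a₁ a₂ : ℝ) : Prop :=
  ∀ c : Fin r → I → I → ℂ,
    (∀ i, seqNorm p q (c i) < ∞) →
    (∀ s t, (∀ z ∈ D₁ ×ˢ D₂, ∀ i, φ i (z.1 - x s, z.2 - y t) = 0) → ∀ i, c i s t = 0) →
    ENNReal.ofReal a₁ * vecSeqNorm p q c
        ≤ mixedNorm p q (μ₁.restrict D₁) (μ₂.restrict D₂) (shiftSum φ x y c) ∧
      mixedNorm p q (μ₁.restrict D₁) (μ₂.restrict D₂) (shiftSum φ x y c)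
        ≤ ENNReal.ofReal a₂ * vecSeqNorm p q c

/-- The local quasi shift-invariant space: the functions in `L^{p,q}(G₁ × G₂)` that agree almost
everywhere on `D₁ × D₂` with `∑_{s,t} c(s,t)ᵀ Φ(· - x_s, · - y_t)` for some `c ∈ (ℓ^{p,q})^r`. -/
def localSpace [MeasurableSpace G₁] [MeasurableSpace G₂] (p q : ℝ)
    (μ₁ : Measure G₁) (μ₂ : Measure G₂) (D₁ : Set G₁) (D₂ : Set G₂)
    (φ : Fin r → G₁ × G₂ → ℂ) (x : I → G₁) (y : I → G₂) : Set (G₁ × G₂ → ℂ) :=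
  {f | Measurable f ∧ mixedNorm p q μ₁ μ₂ f < ∞ ∧
    ∃ c : Fin r → I → I → ℂ, (∀ i, seqNorm p q (c i) < ∞) ∧
      f =ᵐ[haarRect μ₁ μ₂ D₁ D₂] shiftSum φ x y c}

/-- The dimension, as a real vector space, of the local space regarded as a space of (almost
everywhere classes of) functions on `D₁ × D₂`. -/
def localDim [MeasurableSpace G₁] [MeasurableSpace G₂] (p q : ℝ)
    (μ₁ : Measure G₁) (μ₂ : Measure G₂) (D₁ : Set G₁) (D₂ : Set G₂)
    (φ : Fin r → G₁ × G₂ → ℂ) (x : I → G₁) (y : I → G₂) : ℕ :=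
  Set.finrank ℝ {F : (G₁ × G₂) →ₘ[haarRect μ₁ μ₂ D₁ D₂] ℂ |
    ∃ f ∈ localSpace p q μ₁ μ₂ D₁ D₂ φ x y, F =ᵐ[haarRect μ₁ μ₂ D₁ D₂] f}

/-- The functions `f` of the local space on `K̃ = (K₁ - W₁) × (K₂ - W₂)` with
`‖f * ω‖_{L^{p,q}(K₁ × K₂)} ≥ θ` and `‖f‖_{L^{p,q}(K̃)} ≤ α`. -/
def localClass [MeasurableSpace G₁] [MeasurableSpace G₂] (p q : ℝ)
    (μ₁ : Measure G₁) (μ₂ : Measure G₂) (K₁ W₁ : Set G₁) (K₂ W₂ : Set G₂)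
    (φ : Fin r → G₁ × G₂ → ℂ) (x : I → G₁) (y : I → G₂) (ω : G₁ × G₂ → ℂ)
    (θ α : ℝ) : Set (G₁ × G₂ → ℂ) :=
  {f | f ∈ localSpace p q μ₁ μ₂ (K₁ - W₁) (K₂ - W₂) φ x y ∧
    ENNReal.ofReal θ ≤ mixedNorm p q (μ₁.restrict K₁) (μ₂.restrict K₂) (conv μ₁ μ₂ f ω) ∧
    mixedNorm p q (μ₁.restrict (K₁ - W₁)) (μ₂.restrict (K₂ - W₂)) f ≤ ENNReal.ofReal α}

end Shifts

/-! The explicit constants. Here `M₁`, `M₂` are the Haar measures of `K₁`, `K₂`, `w` is the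
`L¹`-norm of `ω`, `C` is the supremum of the shift sums of `|Φ|`, and `a` is the lower stability
bound. -/

/-- The constant `γ C_{ρ,1} M₁^{1-q} M₂^{1-p} (C w / a)^{1-pq}`. -/
def baseConst (p q C₁ M₁ M₂ C w a γ : ℝ) : ℝ :=
  γ * C₁ * M₁ ^ (1 - q) * M₂ ^ (1 - p) * (C / a * w) ^ (1 - p * q)

/-- The lower bound for the number `nm` of samples. -/
def sampleThreshold (p q C₁ M₁ M₂ C w a γ θ α : ℝ) (d : ℕ) : ℝ :=
  108 * √2 * Real.log 2 * d * w * α ^ (2 * p * q)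
      / (baseConst p q C₁ M₁ M₂ C w a γ * θ ^ (p * q)) ^ 2
    * (162 * w + 2 * baseConst p q C₁ M₁ M₂ C w a γ * (θ / α) ^ (p * q))

/-- The lower sampling bound. -/
def lowerBound (p q C₁ M₁ M₂ C w a γ ζ : ℝ) (n m : ℕ) : ℝ :=
  (1 - γ) * C₁ * M₁ ^ (1 - q) * M₂ ^ (1 - p) * (C * w / a) ^ (1 - p * q) * ζ ^ (p * q)
    * (n : ℝ) ^ (1 / p) * (m : ℝ) ^ (1 / q)

/-- The upper sampling bound. -/
def upperBound (p q C₁ C₂ M₁ M₂ C w a γ ζ : ℝ) (n m : ℕ) : ℝ :=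
  C₂ * M₁ ^ ((p - 1) / p) * M₂ ^ ((q - 1) / q) * w * (n * m)
    + γ * C₁ * M₁ ^ (1 - q) * M₂ ^ (1 - p) * (C * w / a) ^ (1 - p * q) * ζ ^ (p * q) * (n * m)

/-- The first exponential rate. -/
def rate₁ (p q C₁ M₁ M₂ C w a γ ζ : ℝ) : ℝ :=
  M₁ ^ (1 - q) * M₂ ^ (1 - p) * (√3 / 2 * γ * C₁ * (a * ζ / (C * w)) ^ (p * q)) ^ 2
    / (6 * M₁ ^ (q - 1) * M₂ ^ (p - 1) + γ * C₁ * (a * ζ / (C * w)) ^ (p * q))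

/-- The second exponential rate. -/
def rate₂ (p q C₁ M₁ M₂ C w a γ ζ : ℝ) : ℝ :=
  M₁ ^ (1 - q) * M₂ ^ (1 - p) * (γ * C₁ * (a * ζ / (C * w)) ^ (p * q) * (C / a)) ^ 2
    / (72 * √2 * (81 * M₁ ^ (q - 1) * M₂ ^ (p - 1)
        + γ * C₁ * (a * ζ / (C * w)) ^ (p * q) * (C / a)))

/-- The first prefactor. -/
def prefactor₁ (C a : ℝ) (d : ℕ) : ℝ :=
  2 * Real.exp (d * Real.log (8 * C / a))

/-- The second prefactor. -/
def prefactor₂ (C a : ℝ) (d : ℕ) : ℝ :=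
  4 / (3 * d * Real.log 2 ^ 2) * (4 * C / a) ^ (2 * d)

end

end RandomAverageSampling

open RandomAverageSampling

/-! Only finitely many shifts of `Φ` meet the compact set `K - W` (`finite_relevantPairs`), so there
every function of the local space is a combination of these shifts with a coefficient vector `e`.
The lower stability bound makes `e` unique, bounds its sup norm by `‖f‖ / a₁`, and identifies `d`
with the real dimension of the coefficient space (`localDim_eq_finrank`). On `K` the average `f * ω`
depends only on `f` on `K - W`, so it equals a function `g e` that is linear in `e` over the reals
and satisfies `|g e| ≤ C ‖e‖ w` (`exists_coeff_of_mem_localClass`, `norm_localAverage_le`).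

The random part is one statement about `ℓ¹` sums: with high probability, the sum of `|g e|` over the
`nm` sample points differs from `nm` times its expectation by at most `nm N`, for all `e` with `a₁
‖e‖ ≤ 1` at once. The family is Lipschitz in `e`, so this follows by chaining Hoeffding's inequality
along `ε`-nets of the unit ball (`measureReal_uniform_deviation_le`). `chaining_bound_le` compares
the resulting probability with the stated Bernstein-type expression. Positive homogeneity extends
the deviation bound to all coefficient vectors.

The passage between `ℓ¹` and mixed norms is deterministic. A function that is bounded by `L` and has
mixed norm at least `θ` cannot have a small integral (`mixedNorm_rpow_le_lintegral`), so the
expectation dominates `N ‖f‖ / γ`, and the deviation costs at most the fraction `γ` of that lower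
bound. From above, the integral of `|f * ω|` is controlled by Hölder and Tonelli
(`lintegral_conv_le`). The sample `ℓ¹` sum dominates the mixed sequence norm (`seqNorm_le_tsum`),
and Hölder bounds it conversely (`sum_enorm_le_seqNorm`). -/

namespace RandomAverageSampling

set_option linter.unusedSectionVars false

/-! ### Covering numbers of the unit ball in finite dimension. -/

section Covering

variable {E : Type*} [NormedAddCommGroup E] [NormedSpace ℝ E] [FiniteDimensional ℝ E]

/-- Volume comparison: the balls of radius `ε/2` about the points are disjoint and lie in the ball
of radius `1 + ε/2`. -/
theorem card_le_of_separated_unitBall {ε : ℝ} (hε : 0 < ε) (s : Finset E)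
    (hs : ∀ c ∈ s, ‖c‖ ≤ 1) (h : ∀ c ∈ s, ∀ d ∈ s, c ≠ d → ε ≤ ‖c - d‖) :
    (s.card : ℝ) ≤ (1 + 2 / ε) ^ Module.finrank ℝ E := by
  borelize E
  let μ : Measure E := Measure.addHaar
  have hδ : 0 < ε / 2 := by positivity
  have hρ : 0 < 1 + ε / 2 := by positivity
  have D : Set.Pairwise (s : Set E) (Function.onFun Disjoint fun c => Metric.ball (c : E) (ε / 2)) := by
    rintro c hc d hd hcd
    apply Metric.ball_disjoint_ball
    rw [dist_eq_norm]
    linarith [h c hc d hd hcd]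
  have A : (⋃ c ∈ s, Metric.ball (c : E) (ε / 2)) ⊆ Metric.ball (0 : E) (1 + ε / 2) := by
    refine Set.iUnion₂_subset fun x hx => Metric.ball_subset_ball' ?_
    rw [dist_zero_right]
    linarith [hs x hx]
  have I : (s.card : ℝ≥0∞) * ENNReal.ofReal ((ε / 2) ^ Module.finrank ℝ E) * μ (Metric.ball 0 1) ≤
      ENNReal.ofReal ((1 + ε / 2) ^ Module.finrank ℝ E) * μ (Metric.ball 0 1) :=
    calc
      _ = μ (⋃ c ∈ s, Metric.ball (c : E) (ε / 2)) := by
        rw [measure_biUnion_finset D fun c _ => measurableSet_ball]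
        simp only [μ.addHaar_ball_of_pos _ hδ, Finset.sum_const, nsmul_eq_mul, mul_assoc]
      _ ≤ μ (Metric.ball (0 : E) (1 + ε / 2)) := measure_mono A
      _ = _ := by simp only [μ.addHaar_ball_of_pos _ hρ]
  have J := (ENNReal.mul_le_mul_iff_left (Metric.measure_ball_pos μ (0 : E) zero_lt_one).ne'
    measure_ball_lt_top.ne).1 I
  have K := ENNReal.toReal_le_of_le_ofReal (pow_nonneg hρ.le _) J
  rw [ENNReal.toReal_mul, ENNReal.toReal_natCast, ENNReal.toReal_ofReal (by positivity)] at K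
  rw [← le_div_iff₀ (by positivity), ← div_pow] at K
  have hbase : 1 + 2 / ε = (1 + ε / 2) / (ε / 2) := by
    field_simp
    ring
  rwa [hbase]

/-- The unit ball of a finite-dimensional space has an `ε`-net with at most `(1 + 2/ε)^d` points. -/
theorem exists_net_unitBall {ε : ℝ} (hε : 0 < ε) :
    ∃ t : Finset E, (∀ e ∈ t, ‖e‖ ≤ 1) ∧ (t.card : ℝ) ≤ (1 + 2 / ε) ^ Module.finrank ℝ E ∧
      ∀ e : E, ‖e‖ ≤ 1 → ∃ a ∈ t, ‖e - a‖ ≤ ε := by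
  classical
  -- A separated subset of maximal cardinality is a net; the packing bound makes the maximum exist.
  let A : Set ℕ := {k | ∃ s : Finset E, (∀ c ∈ s, ‖c‖ ≤ 1) ∧
    (∀ c ∈ s, ∀ d ∈ s, c ≠ d → ε ≤ ‖c - d‖) ∧ s.card = k}
  have hA0 : A.Nonempty := ⟨0, ∅, by simp⟩
  have hAb : BddAbove A := by
    refine ⟨⌊(1 + 2 / ε) ^ Module.finrank ℝ E⌋₊, ?_⟩
    rintro _ ⟨s, h1, h2, rfl⟩
    exact Nat.le_floor (card_le_of_separated_unitBall hε s h1 h2)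
  obtain ⟨s, h1, h2, h3⟩ := Nat.sSup_mem hA0 hAb
  refine ⟨s, h1, card_le_of_separated_unitBall hε s h1 h2, fun e he => ?_⟩
  by_contra! hcon
  have hes : e ∉ s := fun hes => by
    have := hcon e hes
    simp at this
    linarith
  have : (insert e s).card ∈ A := by
    refine ⟨insert e s, ?_, ?_, rfl⟩
    · intro c hc
      rcases Finset.mem_insert.1 hc with rfl | hc
      exacts [he, h1 c hc]
    · intro c hc d hd hcd
      rcases Finset.mem_insert.1 hc with hc' | hc' <;>
        rcases Finset.mem_insert.1 hd with hd' | hd'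
      · exact absurd (hc'.trans hd'.symm) hcd
      · rw [hc']; exact (hcon d hd').le
      · rw [hd', norm_sub_rev]; exact (hcon c hc').le
      · exact h2 c hc' d hd' hcd
  have h4 := le_csSup hAb this
  rw [Finset.card_insert_of_notMem hes, h3] at h4
  omega

end Covering

/-! ### Hoeffding's inequality and chaining. -/

section Deviation

variable {Ω 𝒳 ι : Type*} [MeasurableSpace 𝒳] {Q : Measure 𝒳} {X : ι → Ω → 𝒳}

/-- The centred empirical sum of `g` along the sample points `X i`, `i ∈ s`. -/
noncomputable def empiricalDeviation (Q : Measure 𝒳) (X : ι → Ω → 𝒳) (s : Finset ι) (g : 𝒳 → ℝ)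
    (η : Ω) : ℝ :=
  ∑ i ∈ s, (g (X i η) - ∫ z, g z ∂Q)

theorem empiricalDeviation_sub [IsProbabilityMeasure Q] (s : Finset ι) {g g' : 𝒳 → ℝ}
    (hg : Integrable g Q) (hg' : Integrable g' Q) (η : Ω) :
    empiricalDeviation Q X s (fun z => g z - g' z) η
      = empiricalDeviation Q X s g η - empiricalDeviation Q X s g' η := by
  simp only [empiricalDeviation, integral_sub hg hg', ← Finset.sum_sub_distrib]
  exact Finset.sum_congr rfl fun i _ => by ring

theorem abs_empiricalDeviation_le [IsProbabilityMeasure Q] (s : Finset ι) {g : 𝒳 → ℝ} {δ : ℝ}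
    (hδ : ∀ z, |g z| ≤ δ) (η : Ω) :
    |empiricalDeviation Q X s g η| ≤ s.card * (2 * δ) := by
  have h1 : |∫ z, g z ∂Q| ≤ δ := by
    simpa using norm_integral_le_of_norm_le_const (μ := Q) (f := g) (C := δ)
      (ae_of_all _ fun z => by simpa using hδ z)
  refine (Finset.abs_sum_le_sum_abs _ _).trans ((Finset.sum_le_card_nsmul _ _ (2 * δ)
    fun i _ => ?_).trans_eq (nsmul_eq_mul _ _))
  refine (abs_sub _ _).trans ?_
  linarith [hδ (X i η)]

variable [MeasurableSpace Ω] {P : Measure Ω} [IsProbabilityMeasure P]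

/-- Hoeffding's inequality, two-sided. -/
theorem measureReal_le_abs_empiricalDeviation (hX : ∀ i, HasLaw (X i) Q P) (hind : iIndepFun X P)
    (s : Finset ι) {g : 𝒳 → ℝ} (hg : Measurable g) {a b : ℝ} (hab : ∀ z, g z ∈ Set.Icc a b)
    {ε : ℝ} (hε : 0 ≤ ε) :
    P.real {η | ε ≤ |empiricalDeviation Q X s g η|}
      ≤ 2 * Real.exp (-(2 * ε ^ 2) / (s.card * (b - a) ^ 2)) := by
  have hint : ∀ i, P[fun η => g (X i η)] = ∫ z, g z ∂Q := fun i => by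
    rw [← (hX i).map_eq, integral_map (hX i).aemeasurable hg.aestronglyMeasurable]
  have hsub : ∀ i ∈ s, HasSubgaussianMGF (fun η => g (X i η) - ∫ z, g z ∂Q)
      ((‖b - a‖₊ / 2) ^ 2) P := fun i _ => by
    rw [← hint i]
    exact hasSubgaussianMGF_of_mem_Icc (hg.comp_aemeasurable (hX i).aemeasurable)
      (ae_of_all _ fun η => hab _)
  have hind1 : iIndepFun (fun i η => g (X i η) - ∫ z, g z ∂Q) P :=
    hind.comp (fun _ z => g z - ∫ z, g z ∂Q) (fun _ => hg.sub_const _)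
  have hind2 : iIndepFun (fun i => -(fun η => g (X i η) - ∫ z, g z ∂Q)) P :=
    hind.comp (fun _ z => -(g z - ∫ z, g z ∂Q)) (fun _ => (hg.sub_const _).neg)
  have h1 := HasSubgaussianMGF.measure_sum_ge_le_of_iIndepFun hind1 hsub hε
  have h2 := HasSubgaussianMGF.measure_sum_ge_le_of_iIndepFun hind2
    (fun i hi => (hsub i hi).neg) hε
  have hc : -ε ^ 2 / (2 * ((∑ i ∈ s, (‖b - a‖₊ / 2) ^ 2 : NNReal) : ℝ))
      = -(2 * ε ^ 2) / (s.card * (b - a) ^ 2) := by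
    simp only [Finset.sum_const, nsmul_eq_mul, NNReal.coe_mul, NNReal.coe_natCast, NNReal.coe_pow,
      NNReal.coe_div, coe_nnnorm, Real.norm_eq_abs, NNReal.coe_ofNat, div_pow, sq_abs]
    rw [show (2 * ((s.card : ℝ) * ((b - a) ^ 2 / 2 ^ 2))) = (s.card * (b - a) ^ 2) / 2 by ring,
      div_div_eq_mul_div]
    ring
  push_cast at hc
  rw [NNReal.coe_sum] at h1 h2
  push_cast at h1 h2
  rw [hc] at h1 h2
  refine (measureReal_mono ?_ (by finiteness)).trans
    ((measureReal_union_le _ _).trans ((add_le_add h1 h2).trans_eq (two_mul _).symm))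
  intro η hη
  have hη' : ε ≤ |empiricalDeviation Q X s g η| := hη
  rcases le_abs.1 hη' with h | h
  · exact Or.inl h
  · refine Or.inr ?_
    change ε ≤ _
    simpa [empiricalDeviation] using h

variable {E : Type*} [NormedAddCommGroup E] [NormedSpace ℝ E] [FiniteDimensional ℝ E]

/-- A uniform deviation bound, by chaining, for a Lipschitz family of nonnegative functions indexed
by the unit ball of a finite-dimensional space. The parameter `κ` is the coarsest scale. -/
theorem measureReal_uniform_deviation_le [IsProbabilityMeasure Q]
    (hX : ∀ i, HasLaw (X i) Q P) (hind : iIndepFun X P) (s : Finset ι)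
    {G : E → 𝒳 → ℝ} (hGm : ∀ e, Measurable (G e)) (hG0 : ∀ z, G 0 z = 0) (hGn : ∀ e z, 0 ≤ G e z)
    {L N κ : ℝ} (hL : 0 < L) (hGL : ∀ e e' z, |G e z - G e' z| ≤ L * ‖e - e'‖)
    (hN : 0 < N) (hs : 0 < s.card) (hκ : 0 < κ) (hκ4 : κ ≤ 4) (hd : 1 ≤ Module.finrank ℝ E)
    (hu : 4 * Module.finrank ℝ E * Real.log 2 ≤ s.card * (N / (κ * L)) ^ 2 / 128) :
    P.real {η | ∃ e : E, ‖e‖ ≤ 1 ∧ s.card * N < |empiricalDeviation Q X s (G e) η|}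
      ≤ 2 * (8 / κ) ^ Module.finrank ℝ E * Real.exp (-(s.card * (N / L) ^ 2 / 2))
        + 4 * (8 / κ) ^ (2 * Module.finrank ℝ E)
          * Real.exp (-(3 / 4 * (s.card * (N / (κ * L)) ^ 2 / 128))) := by
  classical
  set d := Module.finrank ℝ E
  set S : ℝ := (s.card : ℝ)
  have hS : 0 < S := by simpa [S] using hs
  set u := S * (N / (κ * L)) ^ 2 / 128 with hudef
  have hnet : ∀ k : ℕ, ∃ t : Finset E, (∀ e ∈ t, ‖e‖ ≤ 1) ∧ (t.card : ℝ) ≤ (8 / κ * 2 ^ k) ^ d ∧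
      ∀ e : E, ‖e‖ ≤ 1 → ∃ a ∈ t, ‖e - a‖ ≤ κ / 2 / 2 ^ k := fun k => by
    obtain ⟨t, h1, h2, h3⟩ := exists_net_unitBall (E := E) (ε := κ / 2 / 2 ^ k) (by positivity)
    refine ⟨t, h1, h2.trans ?_, h3⟩
    gcongr
    have : (1 : ℝ) ≤ 2 ^ k := one_le_pow₀ (by norm_num)
    -- The assumption `κ ≤ 4` is used here, to absorb the additive `1` of the covering bound.
    have h4 : 1 ≤ 4 / κ * 2 ^ k :=
      one_le_mul_of_one_le_of_one_le ((one_le_div hκ).2 hκ4) this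
    have h5 : 2 / (κ / 2 / 2 ^ k) = 4 / κ * 2 ^ k := by field_simp; norm_num
    rw [h5]
    have h6 : 8 / κ * 2 ^ k = 4 / κ * 2 ^ k + 4 / κ * 2 ^ k := by ring
    linarith
  choose T hT1 hTc hTn using hnet
  let Z : E → Ω → ℝ := fun e => empiricalDeviation Q X s (G e)
  have hGle : ∀ e z, G e z ≤ L * ‖e‖ := fun e z => by
    have := hGL e 0 z
    rw [hG0, sub_zero, sub_zero] at this
    exact (le_abs_self _).trans this
  have hGi : ∀ e, Integrable (G e) Q := fun e =>
    Integrable.of_mem_Icc 0 (L * ‖e‖) (hGm e).aemeasurable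
      (ae_of_all _ fun z => ⟨hGn e z, hGle e z⟩)
  have hZL : ∀ e e' η, |Z e η - Z e' η| ≤ S * (2 * (L * ‖e - e'‖)) := fun e e' η => by
    rw [← empiricalDeviation_sub s (hGi e) (hGi e')]
    exact abs_empiricalDeviation_le s (hGL e e') η
  -- The allowed deviation `S * N` is split: one half for the coarsest net, the other half for the
  -- links, since `∑ (1/8) (3/4)^k = 1/2`.
  let B₀ : Set Ω := ⋃ e ∈ T 0, {η | S * N / 2 ≤ |Z e η|}
  let pairs : ℕ → Finset (E × E) := fun k =>
    (T k ×ˢ T (k + 1)).filter fun ab => ‖ab.1 - ab.2‖ ≤ κ / 2 ^ k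
  let B : ℕ → Set Ω := fun k =>
    ⋃ ab ∈ pairs k, {η | S * N / 8 * (3 / 4) ^ k ≤ |Z ab.1 η - Z ab.2 η|}
  have hB0 : P.real B₀ ≤ 2 * (8 / κ) ^ d * Real.exp (-(S * (N / L) ^ 2 / 2)) := by
    refine (measureReal_biUnion_finset_le _ _).trans ?_
    have : ∀ e ∈ T 0, P.real {η | S * N / 2 ≤ |Z e η|}
        ≤ 2 * Real.exp (-(S * (N / L) ^ 2 / 2)) := fun e he => by
      refine (measureReal_le_abs_empiricalDeviation hX hind s (hGm e) (a := 0) (b := L)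
        (fun z => ⟨hGn e z, (hGle e z).trans ?_⟩) (by positivity)).trans_eq ?_
      · nlinarith [hT1 0 e he]
      · congr 2
        change -(2 * (S * N / 2) ^ 2) / (S * _) = _
        rw [sub_zero]
        field_simp
    refine (Finset.sum_le_card_nsmul _ _ _ this).trans ?_
    rw [nsmul_eq_mul]
    have h := hTc 0
    rw [pow_zero, mul_one] at h
    calc _ ≤ (8 / κ) ^ d * (2 * Real.exp (-(S * (N / L) ^ 2 / 2))) := by gcongr
      _ = _ := by ring
  have hBk : ∀ k, P.real (B k) ≤ 2 * (8 / κ) ^ (2 * d) * Real.exp (-(3 / 4 * u) * (k + 1)) := by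
    intro k
    refine (measureReal_biUnion_finset_le _ _).trans ?_
    have : ∀ ab ∈ pairs k, P.real {η | S * N / 8 * (3 / 4) ^ k ≤ |Z ab.1 η - Z ab.2 η|}
        ≤ 2 * Real.exp (-(u * (9 / 4) ^ k)) := fun ab hab => by
      have hle := (Finset.mem_filter.1 hab).2
      have key := measureReal_le_abs_empiricalDeviation hX hind s
        ((hGm ab.1).sub (hGm ab.2)) (a := -(L * (κ / 2 ^ k))) (b := L * (κ / 2 ^ k))
        (fun z => abs_le.1 ((hGL ab.1 ab.2 z).trans (by gcongr)))
        (ε := S * N / 8 * (3 / 4) ^ k) (by positivity)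
      simp only [Pi.sub_def, empiricalDeviation_sub s (hGi ab.1) (hGi ab.2)] at key
      refine key.trans_eq ?_
      congr 2
      change -(2 * _ ^ 2) / (S * _) = _
      -- The squared threshold shrinks like `(9/16)^k` but the squared range of the increment like
      -- `4^(-k)`, so the Hoeffding exponent grows like `(9/4)^k`. The logarithm of the number of
      -- links grows only linearly in `k`.
      have h1 : ((9 / 4 : ℝ)) ^ k = ((3 / 4 : ℝ) ^ k) ^ 2 * (2 ^ k) ^ 2 := by
        rw [← pow_mul, mul_comm k 2, pow_mul, ← pow_mul 2 k 2, mul_comm k 2, pow_mul, ← mul_pow]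
        norm_num
      rw [h1, hudef]
      field_simp
      ring
    refine (Finset.sum_le_card_nsmul _ _ _ this).trans ?_
    rw [nsmul_eq_mul]
    have hcard : ((pairs k).card : ℝ) ≤ (8 / κ) ^ (2 * d) * Real.exp (u / 4 * (2 * k + 1)) := by
      have h1 : ((pairs k).card : ℝ) ≤ (T k).card * (T (k + 1)).card := by
        exact_mod_cast (Finset.card_filter_le _ _).trans_eq (Finset.card_product _ _)
      refine h1.trans ((mul_le_mul (hTc k) (hTc (k + 1)) (by positivity) (by positivity)).trans ?_)
      have h2 : (8 / κ * 2 ^ k) ^ d * (8 / κ * 2 ^ (k + 1)) ^ d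
          = (8 / κ) ^ (2 * d) * ((2 : ℝ) ^ d) ^ (2 * k + 1) := by
        rw [mul_pow, mul_pow, ← pow_mul, ← pow_mul, ← pow_mul, two_mul d, pow_add]
        rw [show d * (2 * k + 1) = k * d + (k + 1) * d by ring, pow_add]
        ring
      rw [h2]
      gcongr
      -- This is the use of `hu`: a quarter of the exponent pays for one factor `2^d` of the net
      -- size.
      have h3 : (2 : ℝ) ^ d ≤ Real.exp (u / 4) := by
        rw [← Real.rpow_natCast, Real.rpow_def_of_pos (by norm_num)]
        gcongr
        linarith
      calc ((2 : ℝ) ^ d) ^ (2 * k + 1) ≤ (Real.exp (u / 4)) ^ (2 * k + 1) := by gcongr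
        _ = _ := by
          rw [← Real.exp_nat_mul]
          push_cast
          ring_nf
    -- Bernoulli's inequality makes the bounds geometric: `(2k + 1)/4 - (1 + 5k/4) = -(3/4)(k + 1)`.
    have hbern : (1 : ℝ) + k * (5 / 4) ≤ (9 / 4) ^ k := by
      have := one_add_mul_le_pow (a := (5 / 4 : ℝ)) (by norm_num) k
      norm_num at this ⊢
      exact this
    have hu0 : 0 ≤ u := by positivity
    calc ((pairs k).card : ℝ) * (2 * Real.exp (-(u * (9 / 4) ^ k)))
        ≤ ((8 / κ) ^ (2 * d) * Real.exp (u / 4 * (2 * k + 1))) *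
            (2 * Real.exp (-(u * (1 + k * (5 / 4))))) := by gcongr
      _ = 2 * (8 / κ) ^ (2 * d) *
            (Real.exp (u / 4 * (2 * k + 1)) * Real.exp (-(u * (1 + k * (5 / 4))))) := by ring
      _ = _ := by
        rw [← Real.exp_add]
        ring_nf
  set r := Real.exp (-(3 / 4 * u)) with hr
  have hr8 : r ≤ 1 / 8 := by
    have h1 : (1 : ℝ) ≤ d := by exact_mod_cast hd
    have h2 := Real.log_pos (show (1 : ℝ) < 2 by norm_num)
    have h3 : 4 * Real.log 2 ≤ u := le_trans (by nlinarith) hu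
    have h4 : r ≤ Real.exp (-(3 * Real.log 2)) := by
      exact Real.exp_le_exp.2 (by linarith)
    refine h4.trans_eq ?_
    rw [Real.exp_neg, show 3 * Real.log 2 = Real.log (2 ^ 3) by rw [Real.log_pow]; norm_num,
      Real.exp_log (by norm_num)]
    norm_num
  have hr0 : 0 < r := Real.exp_pos _
  have hBU : P.real (⋃ k, B k) ≤ 4 * (8 / κ) ^ (2 * d) * r := by
    have hterm : ∀ k, P (B k) ≤ ENNReal.ofReal (2 * (8 / κ) ^ (2 * d) * r * r ^ k) := fun k => by
      rw [← ENNReal.ofReal_toReal (measure_ne_top P (B k))]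
      refine ENNReal.ofReal_le_ofReal ((hBk k).trans_eq ?_)
      have hpow : Real.exp (-(3 / 4 * u) * (k + 1)) = r ^ (k + 1) := by
        rw [hr, ← Real.exp_nat_mul]
        push_cast
        ring_nf
      rw [hpow, pow_succ]
      ring
    have hsum : Summable fun k => 2 * (8 / κ) ^ (2 * d) * r * r ^ k :=
      (summable_geometric_of_lt_one hr0.le (by linarith)).mul_left _
    refine ENNReal.toReal_le_of_le_ofReal (by positivity) ((measure_iUnion_le _).trans
      ((ENNReal.tsum_le_tsum hterm).trans ?_))
    rw [← ENNReal.ofReal_tsum_of_nonneg (fun k => by positivity) hsum, tsum_mul_left,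
      tsum_geometric_of_lt_one hr0.le (by linarith)]
    refine ENNReal.ofReal_le_ofReal ?_
    have h1 : (1 - r)⁻¹ ≤ 2 := by
      rw [inv_le_comm₀ (by linarith) (by norm_num)]; linarith
    calc _ ≤ 2 * (8 / κ) ^ (2 * d) * r * 2 := by gcongr
      _ = _ := by ring
  refine (measureReal_mono (?_ : _ ⊆ B₀ ∪ ⋃ k, B k) (by finiteness)).trans
    ((measureReal_union_le _ _).trans (add_le_add hB0 hBU))
  rintro η ⟨e, he, hbad⟩
  by_contra hη
  simp only [B₀, B, Set.mem_union, Set.mem_iUnion, Set.mem_ofPred_eq, not_or, not_exists, not_le]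
    at hη
  obtain ⟨hη0, hηk⟩ := hη
  choose a haT ha using fun k => hTn k e he
  have hstep : ∀ k, |Z (a k) η - Z (a (k + 1)) η| ≤ S * N / 8 * (3 / 4) ^ k := fun k => by
    refine (hηk k (a k, a (k + 1)) (Finset.mem_filter.2 ⟨Finset.mem_product.2
      ⟨haT k, haT (k + 1)⟩, ?_⟩)).le
    have h1 := ha k
    have h2 := ha (k + 1)
    have h3 : κ / 2 / 2 ^ (k + 1) ≤ κ / 2 / 2 ^ k := by
      gcongr
      · norm_num
      · omega
    calc ‖a k - a (k + 1)‖ = ‖(e - a (k + 1)) - (e - a k)‖ := by congr 1; abel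
      _ ≤ ‖e - a (k + 1)‖ + ‖e - a k‖ := norm_sub_le _ _
      _ ≤ κ / 2 / 2 ^ k + κ / 2 / 2 ^ k := by linarith
      _ = κ / 2 ^ k := by ring
  -- Half of `S * N` from the coarsest net plus the partial geometric sum `S * N / 2 * (1 -
  -- (3/4)^k)` of the links.
  have hind' : ∀ k, |Z (a k) η| ≤ S * N - S * N / 2 * (3 / 4) ^ k := by
    intro k
    induction k with
    | zero => have := (hη0 (a 0) (haT 0)).le; rw [pow_zero]; linarith
    | succ k ih =>
      have h1 := hstep k
      have h2 : |Z (a (k + 1)) η| ≤ |Z (a k) η| + |Z (a k) η - Z (a (k + 1)) η| := by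
        have := abs_sub (Z (a k) η) (Z (a k) η - Z (a (k + 1)) η)
        rwa [sub_sub_cancel] at this
      rw [pow_succ]
      linarith
  -- The point `e` itself is only a limit of net points; the Lipschitz error vanishes as the scale
  -- tends to zero.
  have hlim : Filter.Tendsto (fun k : ℕ => S * N + S * (2 * (L * (κ / 2 / 2 ^ k)))) Filter.atTop
      (𝓝 (S * N + S * (2 * (L * 0)))) := by
    refine tendsto_const_nhds.add (((Filter.Tendsto.const_mul L ?_).const_mul 2).const_mul S)
    have := (tendsto_pow_atTop_nhds_zero_of_lt_one (r := (1 / 2 : ℝ)) (by norm_num)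
      (by norm_num)).const_mul (κ / 2)
    simpa [div_eq_mul_inv] using this
  have hfin : |Z e η| ≤ S * N + S * (2 * (L * 0)) := by
    refine ge_of_tendsto' hlim fun k => ?_
    have h1 := hind' k
    have h2 := hZL e (a k) η
    have h3 : |Z e η| ≤ |Z (a k) η| + |Z e η - Z (a k) η| := by
      have := abs_add_le (Z (a k) η) (Z e η - Z (a k) η)
      rwa [add_sub_cancel] at this
    have h4 : S * (2 * (L * ‖e - a k‖)) ≤ S * (2 * (L * (κ / 2 / 2 ^ k))) := by
      gcongr; exact ha k
    have h5 : 0 ≤ S * N / 2 * (3 / 4) ^ k := by positivity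
    linarith
  rw [mul_zero, mul_zero, mul_zero, add_zero] at hfin
  exact absurd hbad (not_lt.2 hfin)

end Deviation

/-! ### Comparison of mixed norms with the `L¹` norm. -/

section MixedNorm

variable {X Y : Type*} [MeasurableSpace X] [MeasurableSpace Y] {μ : Measure X} {ν : Measure Y}
  {p q : ℝ}

theorem lintegral_le_measure_rpow_mul {p : ℝ} (hp : 1 < p) {g : X → ℝ≥0∞} (hg : AEMeasurable g μ) :
    ∫⁻ x, g x ∂μ ≤ μ Set.univ ^ ((p - 1) / p) * (∫⁻ x, g x ^ p ∂μ) ^ (1 / p) := by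
  have h := ENNReal.lintegral_mul_le_Lp_mul_Lq μ (Real.HolderConjugate.conjExponent hp) hg
    (aemeasurable_const (b := 1))
  have he : 1 / p.conjExponent = (p - 1) / p := by
    rw [Real.conjExponent, one_div_div]
  simpa [he, mul_comm] using h

theorem lintegral_rpow_le_measure_rpow_mul {p : ℝ} (hp : 1 < p) {g : X → ℝ≥0∞}
    (hg : AEMeasurable g μ) :
    (∫⁻ x, g x ∂μ) ^ p ≤ μ Set.univ ^ (p - 1) * ∫⁻ x, g x ^ p ∂μ := by
  have h0 : 0 < p := by linarith
  refine (ENNReal.rpow_le_rpow (lintegral_le_measure_rpow_mul hp hg) h0.le).trans_eq ?_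
  rw [ENNReal.mul_rpow_of_nonneg _ _ h0.le, ← ENNReal.rpow_mul, ← ENNReal.rpow_mul,
    div_mul_cancel₀ _ h0.ne', div_mul_cancel₀ _ h0.ne', ENNReal.rpow_one]

/-- The `L¹` norm is controlled by the mixed norm on a space of finite measure. -/
theorem lintegral_enorm_le_mixedNorm [SFinite ν] (hp : 1 < p) (hq : 1 < q) {f : X × Y → ℂ}
    (hf : Measurable f) :
    ∫⁻ u, ∫⁻ v, ‖f (u, v)‖ₑ ∂ν ∂μ
      ≤ μ Set.univ ^ ((p - 1) / p) * ν Set.univ ^ ((q - 1) / q) * mixedNorm p q μ ν f := by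
  have hq0 : 0 < q := by linarith
  have hA : Measurable fun u => ∫⁻ v, ‖f (u, v)‖ₑ ^ q ∂ν :=
    (hf.enorm.pow_const q).lintegral_prod_right'
  calc ∫⁻ u, ∫⁻ v, ‖f (u, v)‖ₑ ∂ν ∂μ
      ≤ ∫⁻ u, ν Set.univ ^ ((q - 1) / q) * (∫⁻ v, ‖f (u, v)‖ₑ ^ q ∂ν) ^ (1 / q) ∂μ :=
        lintegral_mono fun u => lintegral_le_measure_rpow_mul hq
          (hf.comp measurable_prodMk_left).enorm.aemeasurable
    _ = ν Set.univ ^ ((q - 1) / q) * ∫⁻ u, (∫⁻ v, ‖f (u, v)‖ₑ ^ q ∂ν) ^ (1 / q) ∂μ :=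
        lintegral_const_mul _ (hA.pow_const _)
    _ ≤ ν Set.univ ^ ((q - 1) / q) * (μ Set.univ ^ ((p - 1) / p) *
          (∫⁻ u, ((∫⁻ v, ‖f (u, v)‖ₑ ^ q ∂ν) ^ (1 / q)) ^ p ∂μ) ^ (1 / p)) := by
        gcongr
        exact lintegral_le_measure_rpow_mul hp (hA.pow_const _).aemeasurable
    _ = _ := by
        simp_rw [← ENNReal.rpow_mul, mixedNorm, one_div_mul_eq_div]
        ring

/-- The mixed norm of a function bounded by `L` is controlled by its `L¹` norm. -/
theorem mixedNorm_rpow_le_lintegral [SFinite ν] (hp : 1 < p) (hq : 1 < q) {f : X × Y → ℂ}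
    (hf : Measurable f) {L : ℝ≥0∞} (hfL : ∀ z, ‖f z‖ₑ ≤ L) :
    mixedNorm p q μ ν f ^ (p * q)
      ≤ μ Set.univ ^ (q - 1) * ν Set.univ ^ (p - 1) * L ^ (p * q - 1)
        * ∫⁻ u, ∫⁻ v, ‖f (u, v)‖ₑ ∂ν ∂μ := by
  have hp0 : 0 < p := by linarith
  have hq0 : 0 < q := by linarith
  have hA : Measurable fun u => ∫⁻ v, ‖f (u, v)‖ₑ ^ q ∂ν :=
    (hf.enorm.pow_const q).lintegral_prod_right'
  have h1 : ∀ u, ∫⁻ v, ‖f (u, v)‖ₑ ^ q ∂ν ≤ L ^ (q - 1) * ∫⁻ v, ‖f (u, v)‖ₑ ∂ν := fun u => by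
    have hm : Measurable fun v => ‖f (u, v)‖ₑ := (hf.comp measurable_prodMk_left).enorm
    rw [← lintegral_const_mul _ hm]
    refine lintegral_mono fun v => ?_
    calc ‖f (u, v)‖ₑ ^ q = ‖f (u, v)‖ₑ ^ (q - 1) * ‖f (u, v)‖ₑ := by
          conv_lhs => rw [show q = (q - 1) + 1 by ring]
          rw [ENNReal.rpow_add_of_nonneg _ _ (by linarith) (by norm_num), ENNReal.rpow_one]
      _ ≤ _ := mul_le_mul' (ENNReal.rpow_le_rpow (hfL _) (by linarith)) le_rfl
  have h2 : ∀ u, ∫⁻ v, ‖f (u, v)‖ₑ ^ q ∂ν ≤ L ^ q * ν Set.univ := fun u => by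
    rw [← lintegral_const]
    exact lintegral_mono fun v => ENNReal.rpow_le_rpow (hfL _) hq0.le
  -- Of the `p` powers of the inner integral, `p - 1` are bounded by the supremum and one is kept as
  -- an `L¹` integral.
  have h3 : ∀ u, (∫⁻ v, ‖f (u, v)‖ₑ ^ q ∂ν) ^ p
      ≤ ν Set.univ ^ (p - 1) * L ^ (p * q - 1) * ∫⁻ v, ‖f (u, v)‖ₑ ∂ν := fun u => by
    calc (∫⁻ v, ‖f (u, v)‖ₑ ^ q ∂ν) ^ p
        = (∫⁻ v, ‖f (u, v)‖ₑ ^ q ∂ν) ^ (p - 1) * ∫⁻ v, ‖f (u, v)‖ₑ ^ q ∂ν := by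
          conv_lhs => rw [show p = (p - 1) + 1 by ring]
          rw [ENNReal.rpow_add_of_nonneg _ _ (by linarith) (by norm_num), ENNReal.rpow_one]
      _ ≤ (L ^ q * ν Set.univ) ^ (p - 1) * (L ^ (q - 1) * ∫⁻ v, ‖f (u, v)‖ₑ ∂ν) := by
          gcongr
          · exact h2 u
          · exact h1 u
      _ = _ := by
          rw [ENNReal.mul_rpow_of_nonneg _ _ (by linarith), ← ENNReal.rpow_mul,
            show p * q - 1 = q * (p - 1) + (q - 1) by ring,
            ENNReal.rpow_add_of_nonneg _ _ (by nlinarith) (by linarith)]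
          ring
  have hB : Measurable fun u => ∫⁻ v, ‖f (u, v)‖ₑ ∂ν := hf.enorm.lintegral_prod_right'
  calc mixedNorm p q μ ν f ^ (p * q)
      = (∫⁻ u, (∫⁻ v, ‖f (u, v)‖ₑ ^ q ∂ν) ^ (p / q) ∂μ) ^ q := by
        rw [mixedNorm, ← ENNReal.rpow_mul]
        congr 1
        field_simp
    -- Jensen with exponent `q` in the outer variable turns `p / q` into `p`, so no order between
    -- `p` and `q` is needed.
    _ ≤ μ Set.univ ^ (q - 1) * ∫⁻ u, ((∫⁻ v, ‖f (u, v)‖ₑ ^ q ∂ν) ^ (p / q)) ^ q ∂μ :=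
        lintegral_rpow_le_measure_rpow_mul hq (hA.pow_const _).aemeasurable
    _ = μ Set.univ ^ (q - 1) * ∫⁻ u, (∫⁻ v, ‖f (u, v)‖ₑ ^ q ∂ν) ^ p ∂μ := by
        simp_rw [← ENNReal.rpow_mul, div_mul_cancel₀ p hq0.ne']
    _ ≤ μ Set.univ ^ (q - 1) * ∫⁻ u, ν Set.univ ^ (p - 1) * L ^ (p * q - 1) *
          ∫⁻ v, ‖f (u, v)‖ₑ ∂ν ∂μ := by
        gcongr with u
        exact h3 u
    _ = _ := by
        rw [lintegral_const_mul _ hB]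
        ring

theorem mixedNorm_congr_ae [SFinite ν] {f g : X × Y → ℂ} (h : f =ᵐ[μ.prod ν] g) :
    mixedNorm p q μ ν f = mixedNorm p q μ ν g := by
  rw [mixedNorm, mixedNorm]
  congr 1
  refine lintegral_congr_ae ?_
  filter_upwards [Measure.ae_ae_of_ae_prod h] with u hu
  congr 1
  refine lintegral_congr_ae ?_
  filter_upwards [hu] with v hv
  rw [hv]

theorem mixedNorm_zero (hp : 0 < p) (hq : 0 < q) : mixedNorm p q μ ν (fun _ => 0) = 0 := by
  simp [mixedNorm, hq, hp]

theorem mixedNorm_congr_rect {A : Set X} {B : Set Y} (hA : MeasurableSet A) (hB : MeasurableSet B)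
    {f g : X × Y → ℂ} (h : ∀ z ∈ A ×ˢ B, f z = g z) :
    mixedNorm p q (μ.restrict A) (ν.restrict B) f
      = mixedNorm p q (μ.restrict A) (ν.restrict B) g := by
  rw [mixedNorm, mixedNorm]
  congr 1
  refine setLIntegral_congr_fun hA fun u hu => ?_
  congr 1
  exact setLIntegral_congr_fun hB fun v hv => by simp only [h (u, v) ⟨hu, hv⟩]

theorem mixedNorm_le_of_bound (hp : 0 < p) (hq : 0 < q) {A : Set X} {B : Set Y}
    (hA : MeasurableSet A) (hB : MeasurableSet B) (hAf : μ A ≠ ∞) (hBf : ν B ≠ ∞)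
    {f : X × Y → ℂ} (hf : ∀ z, z ∉ A ×ˢ B → f z = 0) {L : ℝ≥0∞} (hL : L ≠ ∞)
    (hfL : ∀ z, ‖f z‖ₑ ≤ L) :
    mixedNorm p q μ ν f < ∞ := by
  have h1 : ∀ u, ∫⁻ v, ‖f (u, v)‖ₑ ^ q ∂ν ≤ A.indicator (fun _ => L ^ q * ν B) u := fun u => by
    by_cases hu : u ∈ A
    · rw [Set.indicator_of_mem hu, ← lintegral_indicator_const hB]
      refine lintegral_mono fun v => ?_
      by_cases hv : v ∈ B
      · rw [Set.indicator_of_mem hv]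
        exact ENNReal.rpow_le_rpow (hfL _) hq.le
      · simp [hf (u, v) (fun h => hv h.2), hq]
    · simp [hf (u, _) (fun h => hu h.1), hq]
  refine ENNReal.rpow_lt_top_of_nonneg (by positivity) (ne_of_lt ?_)
  calc ∫⁻ u, (∫⁻ v, ‖f (u, v)‖ₑ ^ q ∂ν) ^ (p / q) ∂μ
      ≤ ∫⁻ u, A.indicator (fun _ => (L ^ q * ν B) ^ (p / q)) u ∂μ := by
        refine lintegral_mono fun u => ?_
        refine (ENNReal.rpow_le_rpow (h1 u) (by positivity)).trans_eq ?_
        by_cases hu : u ∈ A <;> simp [hu, hp, hq]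
    _ = (L ^ q * ν B) ^ (p / q) * μ A := lintegral_indicator_const hA _
    _ < ∞ := by finiteness

end MixedNorm

/-! ### Comparison of mixed sequence norms with `ℓ¹`. -/

section SeqNorm

variable {I J : Type*} {p q : ℝ}

/-- In `a t ^ q = a t ^ (q - 1) * a t` the first factor is at most the same power of the whole sum.
-/
theorem tsum_rpow_le_rpow_tsum (hq : 1 ≤ q) (a : I → ℝ≥0∞) :
    ∑' t, a t ^ q ≤ (∑' t, a t) ^ q := by
  have h : ∀ x : ℝ≥0∞, x ^ q = x ^ (q - 1) * x := fun x => by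
    conv_lhs => rw [show q = (q - 1) + 1 by ring]
    rw [ENNReal.rpow_add_of_nonneg _ _ (by linarith) (by norm_num), ENNReal.rpow_one]
  rw [h (∑' t, a t), ← ENNReal.tsum_mul_left]
  refine ENNReal.tsum_le_tsum fun t => ?_
  rw [h]
  exact mul_le_mul' (ENNReal.rpow_le_rpow (ENNReal.le_tsum t) (by linarith)) le_rfl

theorem seqNorm_le_tsum (hp : 1 < p) (hq : 1 < q) (c : I → J → ℂ) :
    seqNorm p q c ≤ ∑' s, ∑' t, ‖c s t‖ₑ := by
  have hp0 : 0 < p := by linarith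
  have hq0 : 0 < q := by linarith
  calc seqNorm p q c ≤ (∑' s, ((∑' t, ‖c s t‖ₑ) ^ q) ^ (p / q)) ^ (1 / p) := by
        rw [seqNorm]
        refine ENNReal.rpow_le_rpow (ENNReal.tsum_le_tsum fun s => ENNReal.rpow_le_rpow ?_
          (by positivity)) (by positivity)
        exact tsum_rpow_le_rpow_tsum hq.le _
    _ = (∑' s, (∑' t, ‖c s t‖ₑ) ^ p) ^ (1 / p) := by
        simp_rw [← ENNReal.rpow_mul, mul_div_cancel₀ p hq0.ne']
    _ ≤ ((∑' s, ∑' t, ‖c s t‖ₑ) ^ p) ^ (1 / p) :=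
        ENNReal.rpow_le_rpow (tsum_rpow_le_rpow_tsum hp.le _) (by positivity)
    _ = _ := by rw [← ENNReal.rpow_mul, mul_one_div_cancel hp0.ne', ENNReal.rpow_one]

theorem enorm_le_seqNorm (hp : 1 < p) (hq : 1 < q) (c : I → J → ℂ) (s : I) (t : J) :
    ‖c s t‖ₑ ≤ seqNorm p q c := by
  have hp0 : 0 < p := by linarith
  have hq0 : 0 < q := by linarith
  calc ‖c s t‖ₑ = ((‖c s t‖ₑ ^ q) ^ (p / q)) ^ (1 / p) := by
        rw [← ENNReal.rpow_mul, ← ENNReal.rpow_mul,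
          show q * (p / q * (1 / p)) = 1 by field_simp, ENNReal.rpow_one]
    _ ≤ _ := by
        rw [seqNorm]
        refine ENNReal.rpow_le_rpow (le_trans (ENNReal.rpow_le_rpow ?_ (by positivity))
          (ENNReal.le_tsum s)) (by positivity)
        exact ENNReal.le_tsum (f := fun t => ‖c s t‖ₑ ^ q) t

theorem seqNorm_lt_top_of_finite (hp : 1 < p) (hq : 1 < q) {c : I → J → ℂ} {R : Set (I × J)}
    (hR : R.Finite) (h : ∀ s t, (s, t) ∉ R → c s t = 0) : seqNorm p q c < ∞ := by
  refine (seqNorm_le_tsum hp hq c).trans_lt ?_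
  rw [← ENNReal.tsum_prod (f := fun s t => ‖c s t‖ₑ), tsum_eq_sum (s := hR.toFinset)]
  · exact ENNReal.sum_lt_top.2 fun _ _ => enorm_lt_top
  · rintro ⟨s, t⟩ hst
    simp [h s t (by simpa using hst)]

/-- This is the mixed-norm Hölder inequality for counting measures. -/
theorem sum_enorm_le_seqNorm (hp : 1 < p) (hq : 1 < q) {n m : ℕ} (c : Fin n → Fin m → ℂ) :
    ∑ j, ∑ k, ‖c j k‖ₑ
      ≤ (n : ℝ≥0∞) ^ ((p - 1) / p) * (m : ℝ≥0∞) ^ ((q - 1) / q) * seqNorm p q c := by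
  have h := lintegral_enorm_le_mixedNorm (μ := (Measure.count : Measure (Fin n)))
    (ν := (Measure.count : Measure (Fin m))) hp hq (f := fun z => c z.1 z.2) (measurable_of_finite _)
  simpa [mixedNorm, seqNorm, lintegral_count, tsum_fintype, Measure.count_univ] using h

end SeqNorm

/-! ### Translations and compact sets in the groups. -/

section Translation

theorem isCompact_sub {G : Type*} [AddGroup G] [TopologicalSpace G] [IsTopologicalAddGroup G]
    {K W : Set G} (hK : IsCompact K) (hW : IsCompact W) : IsCompact (K - W) := by
  rw [sub_eq_add_neg]
  exact hK.add hW.neg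

/-- Compact support gives uniform continuity, hence a neighbourhood independent of `z`. It is taken
to be a rectangle because open rectangles are measurable for the product `σ`-algebra, while general
open sets of the product need not be. -/
theorem exists_open_rect_norm_sub_lt {G₁ G₂ : Type*}
    [AddCommGroup G₁] [TopologicalSpace G₁] [IsTopologicalAddGroup G₁]
    [AddCommGroup G₂] [TopologicalSpace G₂] [IsTopologicalAddGroup G₂]
    {F : G₁ × G₂ → ℂ} (hF : Continuous F)
    (hFc : HasCompactSupport F) {ε : ℝ} (hε : 0 < ε) (w : G₁ × G₂) :
    ∃ (U : Set G₁) (V : Set G₂), IsOpen U ∧ IsOpen V ∧ w ∈ U ×ˢ V ∧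
      ∀ z, ∀ w' ∈ U ×ˢ V, dist (F (z - w)) (F (z - w')) < ε := by
  let : UniformSpace (G₁ × G₂) := IsTopologicalAddGroup.rightUniformSpace (G₁ × G₂)
  have : IsUniformAddGroup (G₁ × G₂) := isUniformAddGroup_of_addCommGroup
  have huc : UniformContinuous F := hFc.uniformContinuous_of_continuous hF
  have h1 := huc (Metric.dist_mem_uniformity hε)
  rw [Filter.mem_map, uniformity_eq_comap_nhds_zero, Filter.mem_comap] at h1
  obtain ⟨N, hN, hNs⟩ := h1
  have h2 : (fun w' : G₁ × G₂ => w - w') ⁻¹' N ∈ 𝓝 w := by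
    have hc : Continuous fun w' : G₁ × G₂ => w - w' := continuous_const.sub continuous_id
    refine hc.continuousAt.preimage_mem_nhds ?_
    rwa [sub_self]
  obtain ⟨U, V, hU, hwU, hV, hwV, hUV⟩ := mem_nhds_prod_iff'.1 h2
  refine ⟨U, V, hU, hV, ⟨hwU, hwV⟩, fun z w' hw' => ?_⟩
  have h3 : w - w' ∈ N := hUV hw'
  exact hNs (a := (z - w, z - w')) (by simpa using h3)

variable {G : Type*} [AddCommGroup G] [TopologicalSpace G] [IsTopologicalAddGroup G]
  [T2Space G] [MeasurableSpace G] [BorelSpace G]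

/-- Translation by `w ∈ W` carries `K` into `K - W` and preserves the measure. -/
theorem setLIntegral_sub_right_le {μ : Measure G} [μ.IsAddLeftInvariant] {K W : Set G}
    (hK : IsCompact K) (hW : IsCompact W) (g : G → ℝ≥0∞) {w : G} (hw : w ∈ W) :
    ∫⁻ v in K, g (v - w) ∂μ ≤ ∫⁻ v in K - W, g v ∂μ := by
  have hKm : MeasurableSet K := hK.isClosed.measurableSet
  have hKWm : MeasurableSet (K - W) := (isCompact_sub hK hW).isClosed.measurableSet
  rw [← lintegral_indicator hKm, ← lintegral_indicator hKWm,
    ← lintegral_sub_right_eq_self ((K - W).indicator g) w]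
  refine lintegral_mono fun v => ?_
  by_cases hv : v ∈ K
  · rw [Set.indicator_of_mem hv, Set.indicator_of_mem (Set.sub_mem_sub hv hw)]
  · rw [Set.indicator_of_notMem hv]
    exact zero_le

/-- The reflection `w ↦ u - w` preserves Haar measure on an abelian group and maps `W` into `K - W`.
It is used to pull back almost everywhere equalities on `K - W` to the integration variable of the
convolution. -/
theorem quasiMeasurePreserving_sub_left_restrict [LocallyCompactSpace G] (μ : Measure G)
    [μ.IsAddHaarMeasure] [μ.Regular] {K W : Set G} (hK : IsCompact K) (hW : IsCompact W) {u : G}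
    (hu : u ∈ K) :
    Measure.QuasiMeasurePreserving (fun w => u - w) (μ.restrict W) (μ.restrict (K - W)) := by
  have hKWm : MeasurableSet (K - W) := (isCompact_sub hK hW).isClosed.measurableSet
  refine ((Measure.measurePreserving_sub_left μ u).restrict_preimage
    hKWm).quasiMeasurePreserving.mono_left
    (Measure.absolutelyContinuous_of_le (Measure.restrict_mono ?_ le_rfl))
  exact fun w hw => Set.sub_mem_sub hu hw

end Translation

/-! ### Convolution with a function supported in a compact rectangle. -/

section Convolution

variable {G₁ G₂ : Type*}
  [AddCommGroup G₁] [TopologicalSpace G₁] [IsTopologicalAddGroup G₁]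
  [T2Space G₁] [MeasurableSpace G₁] [BorelSpace G₁]
  [AddCommGroup G₂] [TopologicalSpace G₂] [IsTopologicalAddGroup G₂]
  [T2Space G₂] [MeasurableSpace G₂] [BorelSpace G₂]

theorem measurable_const_sub_prod (z : G₁ × G₂) : Measurable fun w : G₁ × G₂ => z - w :=
  (measurable_fst.const_sub z.1).prodMk (measurable_snd.const_sub z.2)

theorem measurable_sub_const_prod (w : G₁ × G₂) : Measurable fun z : G₁ × G₂ => z - w :=
  (measurable_fst.sub_const w.1).prodMk (measurable_snd.sub_const w.2)

/-- The function `(z, w) ↦ F (z - w)`, cut off to a compact rectangle in `w`, is measurable for the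
product `σ`-algebra, although subtraction itself need not be. -/
theorem measurable_indicator_comp_sub {F : G₁ × G₂ → ℂ} (hF : Continuous F)
    (hFc : HasCompactSupport F) {W₁ : Set G₁} {W₂ : Set G₂} (hW₁ : IsCompact W₁)
    (hW₂ : IsCompact W₂) :
    Measurable fun p : (G₁ × G₂) × (G₁ × G₂) =>
      (W₁ ×ˢ W₂).indicator (fun w => F (p.1 - w)) p.2 := by
  classical
  have hFm : Measurable F := hFc.measurable_of_prod hF
  have hWm : MeasurableSet (W₁ ×ˢ W₂) :=
    hW₁.isClosed.measurableSet.prod hW₂.isClosed.measurableSet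
  -- Finitely many rectangles about points `a` cover `W`; replacing `F (z - w)` by `F (z - a)` on
  -- the rectangle of `a` gives a measurable uniform approximation, piecewise constant in `w`.
  have happrox : ∀ k : ℕ, ∃ H : (G₁ × G₂) × (G₁ × G₂) → ℂ, Measurable H ∧
      ∀ z, ∀ w ∈ W₁ ×ˢ W₂, dist (H (z, w)) (F (z - w)) < 1 / ((k : ℝ) + 1) := fun k => by
    choose U V hU hV hmem hUV using
      fun w => exists_open_rect_norm_sub_lt hF hFc (Nat.one_div_pos_of_nat (α := ℝ) (n := k)) w
    obtain ⟨t, -, ht⟩ := (hW₁.prod hW₂).elim_nhds_subcover (fun w => U w ×ˢ V w)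
      fun w _ => ((hU w).prod (hV w)).mem_nhds (hmem w)
    have hfin : ∀ t : Finset (G₁ × G₂), ∃ H : (G₁ × G₂) × (G₁ × G₂) → ℂ, Measurable H ∧
        ∀ z, ∀ w ∈ ⋃ a ∈ t, U a ×ˢ V a, dist (H (z, w)) (F (z - w)) < 1 / ((k : ℝ) + 1) := by
      intro t
      induction t using Finset.induction_on with
      | empty => exact ⟨fun _ => 0, measurable_const, by simp⟩
      | insert a t _ ih =>
        obtain ⟨H, hHm, hH⟩ := ih
        have hset : MeasurableSet {p : (G₁ × G₂) × (G₁ × G₂) | p.2 ∈ U a ×ˢ V a} :=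
          measurable_snd ((hU a).measurableSet.prod (hV a).measurableSet)
        refine ⟨fun p => if p.2 ∈ U a ×ˢ V a then F (p.1 - a) else H p, Measurable.ite hset
          (hFm.comp ((measurable_sub_const_prod a).comp measurable_fst)) hHm, fun z w hw => ?_⟩
        by_cases hwa : w ∈ U a ×ˢ V a
        · simpa only [if_pos hwa] using hUV a z w hwa
        · simp only [if_neg hwa]
          refine hH z w ?_
          simpa only [Finset.set_biUnion_insert, Set.mem_union, hwa, false_or] using hw
    obtain ⟨H, hHm, hH⟩ := hfin t
    exact ⟨H, hHm, fun z w hw => hH z w (ht hw)⟩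
  choose H hHm hH using happrox
  have hset : MeasurableSet {p : (G₁ × G₂) × (G₁ × G₂) | p.2 ∈ W₁ ×ˢ W₂} := measurable_snd hWm
  refine measurable_of_tendsto_metrizable
    (f := fun k p => if p.2 ∈ W₁ ×ˢ W₂ then H k p else 0)
    (fun k => Measurable.ite hset (hHm k) measurable_const) (tendsto_pi_nhds.2 fun p => ?_)
  by_cases hp : p.2 ∈ W₁ ×ˢ W₂
  · simp only [if_pos hp, Set.indicator_of_mem hp]
    rw [tendsto_iff_dist_tendsto_zero]
    exact squeeze_zero (fun _ => dist_nonneg) (fun k => (hH k p.1 p.2 hp).le)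
      tendsto_one_div_add_atTop_nhds_zero_nat
  · simp only [if_neg hp, Set.indicator_of_notMem hp]
    exact tendsto_const_nhds

variable {μ₁ : Measure G₁} {μ₂ : Measure G₂} {W₁ : Set G₁} {W₂ : Set G₂} {ω : G₁ × G₂ → ℂ}

theorem ae_haarRect_mem [IsFiniteMeasureOnCompacts μ₁] [IsFiniteMeasureOnCompacts μ₂]
    (hW₁ : IsCompact W₁) (hW₂ : IsCompact W₂) : ∀ᵐ w ∂(haarRect μ₁ μ₂ W₁ W₂), w ∈ W₁ ×ˢ W₂ := by
  have h1 : ∀ᵐ w ∂(haarRect μ₁ μ₂ W₁ W₂), w.1 ∈ W₁ := Measure.quasiMeasurePreserving_fst.ae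
    (ae_restrict_mem hW₁.isClosed.measurableSet)
  have h2 : ∀ᵐ w ∂(haarRect μ₁ μ₂ W₁ W₂), w.2 ∈ W₂ := Measure.quasiMeasurePreserving_snd.ae
    (ae_restrict_mem hW₂.isClosed.measurableSet)
  filter_upwards [h1, h2] with w hw1 hw2 using ⟨hw1, hw2⟩

theorem isFiniteMeasure_restrict_of_isCompact {G : Type*} [TopologicalSpace G] [MeasurableSpace G]
    (μ : Measure G) [IsFiniteMeasureOnCompacts μ] {K : Set G} (hK : IsCompact K) :
    IsFiniteMeasure (μ.restrict K) :=
  ⟨by simpa using hK.measure_lt_top⟩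

theorem isFiniteMeasure_haarRect [IsFiniteMeasureOnCompacts μ₁] [IsFiniteMeasureOnCompacts μ₂]
    (hW₁ : IsCompact W₁) (hW₂ : IsCompact W₂) : IsFiniteMeasure (haarRect μ₁ μ₂ W₁ W₂) := by
  have := isFiniteMeasure_restrict_of_isCompact μ₁ hW₁
  have := isFiniteMeasure_restrict_of_isCompact μ₂ hW₂
  unfold haarRect
  infer_instance

/-- Restricting to the compact `W₁`, `W₂` makes both measures finite, so Fubini applies although
Haar measure need not be `σ`-finite. -/
theorem conv_eq_setIntegral (hω : Function.support ω ⊆ W₁ ×ˢ W₂) (f : G₁ × G₂ → ℂ)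
    (z : G₁ × G₂) :
    conv μ₁ μ₂ f ω z
      = ∫ u in W₁, ∫ v in W₂, f (z.1 - u, z.2 - v) * ω (u, v) ∂μ₂ ∂μ₁ := by
  have h0 : ∀ w, w ∉ W₁ ×ˢ W₂ → ω w = 0 := fun w hw => by
    by_contra h
    exact hw (hω h)
  have h1 : ∀ u, ∫ v in W₂, f (z.1 - u, z.2 - v) * ω (u, v) ∂μ₂
      = ∫ v, f (z.1 - u, z.2 - v) * ω (u, v) ∂μ₂ := fun u =>
    setIntegral_eq_integral_of_forall_compl_eq_zero fun v hv => by
      rw [h0 (u, v) fun h => hv h.2, mul_zero]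
  simp_rw [h1]
  rw [setIntegral_eq_integral_of_forall_compl_eq_zero]
  · rfl
  · intro u hu
    have h2 : ∀ v, f (z.1 - u, z.2 - v) * ω (u, v) = 0 := fun v => by
      rw [h0 (u, v) fun h => hu h.1, mul_zero]
    simp [h2]

/-- On `K`, the convolution with a function supported in `W` depends only on the values on
`K - W`. -/
theorem conv_congr_ae [LocallyCompactSpace G₁] [LocallyCompactSpace G₂]
    [μ₁.IsAddHaarMeasure] [μ₁.Regular] [μ₂.IsAddHaarMeasure] [μ₂.Regular]
    {K₁ : Set G₁} {K₂ : Set G₂} (hK₁ : IsCompact K₁) (hK₂ : IsCompact K₂)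
    (hW₁ : IsCompact W₁) (hW₂ : IsCompact W₂) (hω : Function.support ω ⊆ W₁ ×ˢ W₂)
    {f g : G₁ × G₂ → ℂ} (hfg : f =ᵐ[haarRect μ₁ μ₂ (K₁ - W₁) (K₂ - W₂)] g)
    {z : G₁ × G₂} (hz : z ∈ K₁ ×ˢ K₂) : conv μ₁ μ₂ f ω z = conv μ₁ μ₂ g ω z := by
  have := isFiniteMeasure_restrict_of_isCompact μ₁ hW₁
  have := isFiniteMeasure_restrict_of_isCompact μ₂ hW₂
  have := isFiniteMeasure_restrict_of_isCompact μ₂ (isCompact_sub hK₂ hW₂)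
  rw [conv_eq_setIntegral hω, conv_eq_setIntegral hω]
  have hq := QuasiMeasurePreserving.prodMap (quasiMeasurePreserving_sub_left_restrict μ₁ hK₁ hW₁ hz.1)
    (quasiMeasurePreserving_sub_left_restrict μ₂ hK₂ hW₂ hz.2)
  have h := Measure.ae_ae_of_ae_prod (hq.ae hfg)
  refine integral_congr_ae ?_
  filter_upwards [h] with u hu
  refine integral_congr_ae ?_
  filter_upwards [hu] with v hv
  simp only [Prod.map] at hv
  rw [hv]

variable [IsFiniteMeasureOnCompacts μ₁] [IsFiniteMeasureOnCompacts μ₂]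

theorem integrable_comp_sub_mul (hωi : Integrable ω (haarRect μ₁ μ₂ W₁ W₂)) {F : G₁ × G₂ → ℂ}
    (hF : Measurable F) {B : ℝ} (hB : ∀ z, ‖F z‖ ≤ B) (z : G₁ × G₂) :
    Integrable (fun w => F (z - w) * ω w) (haarRect μ₁ μ₂ W₁ W₂) :=
  hωi.bdd_mul (hF.comp (measurable_const_sub_prod z)).aestronglyMeasurable
    (ae_of_all _ fun _ => hB _)

theorem conv_eq_integral_haarRect (hW₁ : IsCompact W₁) (hW₂ : IsCompact W₂)
    (hω : Function.support ω ⊆ W₁ ×ˢ W₂)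
    (hωi : Integrable ω (haarRect μ₁ μ₂ W₁ W₂)) {F : G₁ × G₂ → ℂ}
    (hF : Measurable F) {B : ℝ} (hB : ∀ z, ‖F z‖ ≤ B) (z : G₁ × G₂) :
    conv μ₁ μ₂ F ω z = ∫ w, F (z - w) * ω w ∂(haarRect μ₁ μ₂ W₁ W₂) := by
  have := isFiniteMeasure_restrict_of_isCompact μ₁ hW₁
  have := isFiniteMeasure_restrict_of_isCompact μ₂ hW₂
  rw [conv_eq_setIntegral hω]
  exact (integral_prod _ (integrable_comp_sub_mul hωi hF hB z)).symm

theorem norm_conv_le (hW₁ : IsCompact W₁) (hW₂ : IsCompact W₂)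
    (hω : Function.support ω ⊆ W₁ ×ˢ W₂)
    (hωi : Integrable ω (haarRect μ₁ μ₂ W₁ W₂)) {F : G₁ × G₂ → ℂ}
    (hF : Measurable F) {B : ℝ} (hB : ∀ z, ‖F z‖ ≤ B) {z : G₁ × G₂} {A : ℝ}
    (hA : ∀ w ∈ W₁ ×ˢ W₂, ‖F (z - w)‖ ≤ A) :
    ‖conv μ₁ μ₂ F ω z‖ ≤ A * ∫ w, ‖ω w‖ ∂(haarRect μ₁ μ₂ W₁ W₂) := by
  rw [conv_eq_integral_haarRect hW₁ hW₂ hω hωi hF hB, ← integral_const_mul]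
  refine norm_integral_le_of_norm_le (hωi.norm.const_mul A) ?_
  filter_upwards [ae_haarRect_mem hW₁ hW₂] with w hw
  rw [norm_mul]
  gcongr
  exact hA w hw

/-- Parameter integrals of jointly measurable integrands are measurable. Joint measurability comes
from cutting off to `W` and from replacing `ω` by a strongly measurable representative. -/
theorem measurable_conv (hW₁ : IsCompact W₁) (hW₂ : IsCompact W₂)
    (hω : Function.support ω ⊆ W₁ ×ˢ W₂)
    (hωi : Integrable ω (haarRect μ₁ μ₂ W₁ W₂)) {F : G₁ × G₂ → ℂ} (hF : Continuous F)
    (hFc : HasCompactSupport F) : Measurable (conv μ₁ μ₂ F ω) := by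
  have := isFiniteMeasure_haarRect (μ₁ := μ₁) (μ₂ := μ₂) hW₁ hW₂
  obtain ⟨B, hB⟩ := hFc.exists_bound_of_continuous hF
  have hm := (measurable_indicator_comp_sub hF hFc hW₁ hW₂).mul
    (hωi.1.stronglyMeasurable_mk.measurable.comp measurable_snd)
  have h := (hm.stronglyMeasurable.integral_prod_right' (ν := haarRect μ₁ μ₂ W₁ W₂)).measurable
  convert h using 1
  funext z
  rw [conv_eq_integral_haarRect hW₁ hW₂ hω hωi (hFc.measurable_of_prod hF) hB]
  refine integral_congr_ae ?_
  filter_upwards [ae_haarRect_mem hW₁ hW₂, hωi.1.ae_eq_mk] with w hw hwω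
  simp only [Pi.mul_apply, Function.comp_apply, Set.indicator_of_mem hw, ← hwω]

/-- The `L¹` norm of the convolution over `K` is controlled by the mixed norm of `F` over `K - W`. -/
theorem lintegral_conv_le [μ₁.IsAddLeftInvariant] [μ₂.IsAddLeftInvariant] {p q : ℝ} (hp : 1 < p)
    (hq : 1 < q) {K₁ : Set G₁} {K₂ : Set G₂} (hK₁ : IsCompact K₁) (hK₂ : IsCompact K₂)
    (hW₁ : IsCompact W₁) (hW₂ : IsCompact W₂) (hω : Function.support ω ⊆ W₁ ×ˢ W₂)
    (hωi : Integrable ω (haarRect μ₁ μ₂ W₁ W₂)) {F : G₁ × G₂ → ℂ} (hF : Continuous F)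
    (hFc : HasCompactSupport F) :
    ∫⁻ z, ‖conv μ₁ μ₂ F ω z‖ₑ ∂(haarRect μ₁ μ₂ K₁ K₂)
      ≤ μ₁ K₁ ^ ((p - 1) / p) * μ₂ K₂ ^ ((q - 1) / q)
        * ENNReal.ofReal (∫ w, ‖ω w‖ ∂(haarRect μ₁ μ₂ W₁ W₂))
        * mixedNorm p q (μ₁.restrict (K₁ - W₁)) (μ₂.restrict (K₂ - W₂)) F := by
  have := isFiniteMeasure_haarRect (μ₁ := μ₁) (μ₂ := μ₂) hW₁ hW₂
  have := isFiniteMeasure_haarRect (μ₁ := μ₁) (μ₂ := μ₂) hK₁ hK₂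
  have := isFiniteMeasure_restrict_of_isCompact μ₂ hK₂
  have hFm : Measurable F := hFc.measurable_of_prod hF
  obtain ⟨B, hB⟩ := hFc.exists_bound_of_continuous hF
  have hm := measurable_indicator_comp_sub hF hFc hW₁ hW₂
  have hq0 : 0 < q := by linarith
  set c := μ₁ K₁ ^ ((p - 1) / p) * μ₂ K₂ ^ ((q - 1) / q)
  set A := mixedNorm p q (μ₁.restrict (K₁ - W₁)) (μ₂.restrict (K₂ - W₂)) F
  -- For fixed `w`, Hölder on `K` followed by translation in each variable; integrating against
  -- `|ω|` by Tonelli then gives the claim.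
  have hshift : ∀ w ∈ W₁ ×ˢ W₂, ∫⁻ z, ‖F (z - w)‖ₑ ∂(haarRect μ₁ μ₂ K₁ K₂) ≤ c * A := by
    intro w hw
    have hFw : Measurable fun z => F (z - w) := hFm.comp (measurable_sub_const_prod w)
    rw [haarRect, lintegral_prod _ hFw.enorm.aemeasurable]
    refine (lintegral_enorm_le_mixedNorm hp hq hFw).trans ?_
    rw [Measure.restrict_apply_univ, Measure.restrict_apply_univ]
    refine mul_le_mul' le_rfl (ENNReal.rpow_le_rpow ?_ (by positivity))
    calc ∫⁻ u in K₁, (∫⁻ v in K₂, ‖F ((u, v) - w)‖ₑ ^ q ∂μ₂) ^ (p / q) ∂μ₁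
        ≤ ∫⁻ u in K₁, (∫⁻ v in K₂ - W₂, ‖F (u - w.1, v)‖ₑ ^ q ∂μ₂) ^ (p / q) ∂μ₁ := by
          refine lintegral_mono fun u => ENNReal.rpow_le_rpow ?_ (by positivity)
          exact setLIntegral_sub_right_le hK₂ hW₂ (fun v => ‖F (u - w.1, v)‖ₑ ^ q) hw.2
      _ ≤ _ := setLIntegral_sub_right_le hK₁ hW₁
          (fun u => (∫⁻ v in K₂ - W₂, ‖F (u, v)‖ₑ ^ q ∂μ₂) ^ (p / q)) hw.1
  calc ∫⁻ z, ‖conv μ₁ μ₂ F ω z‖ₑ ∂(haarRect μ₁ μ₂ K₁ K₂)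
      ≤ ∫⁻ z, ∫⁻ w, ‖(W₁ ×ˢ W₂).indicator (fun w => F (z - w)) w * ω w‖ₑ
          ∂(haarRect μ₁ μ₂ W₁ W₂) ∂(haarRect μ₁ μ₂ K₁ K₂) := by
        refine lintegral_mono fun z => ?_
        dsimp only
        rw [conv_eq_integral_haarRect hW₁ hW₂ hω hωi hFm hB]
        refine (enorm_integral_le_lintegral_enorm _).trans_eq (lintegral_congr_ae ?_)
        filter_upwards [ae_haarRect_mem hW₁ hW₂] with w hw
        rw [Set.indicator_of_mem hw]
    _ = ∫⁻ w, ∫⁻ z, ‖(W₁ ×ˢ W₂).indicator (fun w => F (z - w)) w * ω w‖ₑ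
          ∂(haarRect μ₁ μ₂ K₁ K₂) ∂(haarRect μ₁ μ₂ W₁ W₂) := by
        refine lintegral_lintegral_swap ?_
        exact (hm.aemeasurable.mul hωi.1.aemeasurable.comp_snd).enorm
    _ ≤ ∫⁻ w, c * A * ‖ω w‖ₑ ∂(haarRect μ₁ μ₂ W₁ W₂) := by
        refine lintegral_mono_ae ?_
        filter_upwards [ae_haarRect_mem hW₁ hW₂] with w hw
        simp only [Set.indicator_of_mem hw, enorm_mul]
        rw [lintegral_mul_const' _ _ enorm_ne_top]
        gcongr
        exact hshift w hw
    _ = _ := by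
        rw [lintegral_const_mul'' _ hωi.1.enorm, ofReal_integral_norm_eq_lintegral_enorm hωi]
        ring

end Convolution

/-! ### Separated families and compact supports. -/

section Separated

/-- Finitely many translates `a + U` cover `A`, and each contains at most one `x s`: if `x s` and `x
s'` lie in `a + U`, then `x s + x s' - a` lies in both `x s + U` and `x s' + U`. -/
theorem IsSeparatedFamily.finite_mem {G I : Type*} [AddCommGroup G] [TopologicalSpace G]
    [IsTopologicalAddGroup G] {x : I → G} (hx : IsSeparatedFamily x) {A : Set G}
    (hA : IsCompact A) : {s | x s ∈ A}.Finite := by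
  obtain ⟨U, hU, hd⟩ := hx
  obtain ⟨t, -, ht⟩ := hA.elim_nhds_subcover (fun a => (fun g => g - a) ⁻¹' U) fun a _ => by
    have hc : Continuous fun g : G => g - a := continuous_id.sub continuous_const
    refine hc.continuousAt.preimage_mem_nhds ?_
    rwa [sub_self]
  refine ((t.finite_toSet.biUnion (t := fun a => {s | x s - a ∈ U}) fun a _ => ?_)).subset ?_
  · refine Set.Subsingleton.finite fun s hs s' hs' => ?_
    by_contra hne
    refine Set.disjoint_left.1 (hd hne)
      (show x s + (x s' - a) ∈ (x s + ·) '' U from ⟨_, hs', rfl⟩) ⟨x s - a, hs, ?_⟩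
    change x s' + (x s - a) = x s + (x s' - a)
    abel
  · intro s hs
    simpa using ht hs

theorem hasCompactSupport_finset_sum {X ι : Type*} [TopologicalSpace X] (t : Finset ι)
    {f : ι → X → ℂ} (h : ∀ i ∈ t, HasCompactSupport (f i)) :
    HasCompactSupport fun z => ∑ i ∈ t, f i z := by
  classical
  induction t using Finset.induction_on with
  | empty =>
    simp only [Finset.sum_empty]
    exact HasCompactSupport.zero
  | insert a t ha ih =>
    simp only [Finset.sum_insert ha]
    exact (h a (Finset.mem_insert_self a t)).add
      (ih fun i hi => h i (Finset.mem_insert_of_mem hi))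

end Separated

/-! ### Finite-dimensional parametrisation of the local space. -/

section Coefficients

variable {G₁ G₂ I : Type*} [AddCommGroup G₁] [AddCommGroup G₂] {r : ℕ}

/-- The pairs `(s,t)` for which the shift of `Φ` by `(x_s, y_t)` does not vanish on `D`. -/
def relevantPairs (φ : Fin r → G₁ × G₂ → ℂ) (x : I → G₁) (y : I → G₂) (D : Set (G₁ × G₂)) :
    Set (I × I) :=
  {st | ∃ z ∈ D, ∃ i, φ i (z.1 - x st.1, z.2 - y st.2) ≠ 0}

/-- A shift that is nonzero somewhere on `D` has `x s` and `y t` in the compact sets obtained by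
subtracting from `D₁`, `D₂` the projections of the supports. -/
theorem finite_relevantPairs [TopologicalSpace G₁] [IsTopologicalAddGroup G₁] [TopologicalSpace G₂]
    [IsTopologicalAddGroup G₂] {φ : Fin r → G₁ × G₂ → ℂ} (hφ : ∀ i, HasCompactSupport (φ i))
    {x : I → G₁} {y : I → G₂} (hx : IsSeparatedFamily x) (hy : IsSeparatedFamily y) {D₁ : Set G₁}
    {D₂ : Set G₂} (hD₁ : IsCompact D₁) (hD₂ : IsCompact D₂) :
    (relevantPairs φ x y (D₁ ×ˢ D₂)).Finite := by
  have hT : IsCompact (⋃ i, tsupport (φ i)) := isCompact_iUnion fun i => (hφ i).isCompact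
  refine ((hx.finite_mem (isCompact_sub hD₁ (hT.image continuous_fst))).prod
    (hy.finite_mem (isCompact_sub hD₂ (hT.image continuous_snd)))).subset ?_
  rintro ⟨s, t⟩ ⟨z, hz, i, hi⟩
  have hmem : (z.1 - x s, z.2 - y t) ∈ ⋃ i, tsupport (φ i) :=
    Set.mem_iUnion.2 ⟨i, subset_tsupport _ hi⟩
  refine ⟨?_, ?_⟩
  · have := Set.sub_mem_sub hz.1 (Set.mem_image_of_mem Prod.fst hmem)
    simpa using this
  · have := Set.sub_mem_sub hz.2 (Set.mem_image_of_mem Prod.snd hmem)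
    simpa using this

open Classical in
/-- Extension by zero of a coefficient vector indexed by the finite set `R`. -/
noncomputable def extendCoeff (R : Finset (I × I)) (e : Fin r × R → ℂ) : Fin r → I → I → ℂ :=
  fun i s t => if h : (s, t) ∈ R then e (i, ⟨(s, t), h⟩) else 0

/-- The finite combination of shifts with coefficient vector `e`. -/
noncomputable def shiftCombination (φ : Fin r → G₁ × G₂ → ℂ) (x : I → G₁) (y : I → G₂)
    (R : Finset (I × I)) (e : Fin r × R → ℂ) (z : G₁ × G₂) : ℂ :=
  ∑ st : R, ∑ i, e (i, st) * φ i (z - (x st.1.1, y st.1.2))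

variable {φ : Fin r → G₁ × G₂ → ℂ} {x : I → G₁} {y : I → G₂} {R : Finset (I × I)}

theorem extendCoeff_of_notMem (e : Fin r × R → ℂ) (i : Fin r) {s t : I} (h : (s, t) ∉ R) :
    extendCoeff R e i s t = 0 := dif_neg h

theorem extendCoeff_coe (e : Fin r × R → ℂ) (i : Fin r) (st : R) :
    extendCoeff R e i st.1.1 st.1.2 = e (i, st) := dif_pos st.2

theorem shiftSum_extendCoeff (e : Fin r × R → ℂ) (z : G₁ × G₂) :
    shiftSum φ x y (extendCoeff R e) z = shiftCombination φ x y R e z := by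
  rw [shiftSum, tsum_eq_sum (s := R), shiftCombination, ← Finset.sum_coe_sort]
  · exact Finset.sum_congr rfl fun st _ => Finset.sum_congr rfl fun i _ => by
      rw [extendCoeff_coe]; rfl
  · rintro ⟨s, t⟩ hst
    simp [extendCoeff_of_notMem e _ hst]

theorem shiftSum_eq_shiftCombination {D : Set (G₁ × G₂)}
    (hR : ∀ st, st ∈ R ↔ st ∈ relevantPairs φ x y D) (c : Fin r → I → I → ℂ) {z : G₁ × G₂}
    (hz : z ∈ D) :
    shiftSum φ x y c z
      = shiftCombination φ x y R (fun ist => c ist.1 ist.2.1.1 ist.2.1.2) z := by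
  rw [shiftSum, tsum_eq_sum (s := R), shiftCombination, ← Finset.sum_coe_sort]
  · rfl
  · intro st hst
    refine Finset.sum_eq_zero fun i _ => ?_
    have : φ i (z.1 - x st.1, z.2 - y st.2) = 0 := by
      by_contra h
      exact hst ((hR st).2 ⟨z, hz, i, h⟩)
    rw [this, mul_zero]

theorem shiftCombination_add (e e' : Fin r × R → ℂ) (z : G₁ × G₂) :
    shiftCombination φ x y R (e + e') z
      = shiftCombination φ x y R e z + shiftCombination φ x y R e' z := by
  simp only [shiftCombination, Pi.add_apply, add_mul, Finset.sum_add_distrib]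

theorem shiftCombination_smul (a : ℝ) (e : Fin r × R → ℂ) (z : G₁ × G₂) :
    shiftCombination φ x y R (a • e) z = a * shiftCombination φ x y R e z := by
  simp only [shiftCombination, Pi.smul_apply, Complex.real_smul, Finset.mul_sum, mul_assoc]

section Topology

variable [TopologicalSpace G₁] [IsTopologicalAddGroup G₁] [TopologicalSpace G₂]
  [IsTopologicalAddGroup G₂]

theorem continuous_shiftCombination (hφ : ∀ i, Continuous (φ i)) (e : Fin r × R → ℂ) :
    Continuous (shiftCombination φ x y R e) :=
  continuous_finsetSum _ fun _ _ => continuous_finsetSum _ fun i _ =>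
    continuous_const.mul ((hφ i).comp (continuous_id.sub continuous_const))

theorem hasCompactSupport_shiftCombination (hφ : ∀ i, HasCompactSupport (φ i))
    (e : Fin r × R → ℂ) : HasCompactSupport (shiftCombination φ x y R e) :=
  hasCompactSupport_finset_sum _ fun st _ => hasCompactSupport_finset_sum _ fun i _ =>
    HasCompactSupport.mul_left (f := fun _ => e (i, st))
      ((hφ i).comp_homeomorph (Homeomorph.subRight (x st.1.1, y st.1.2)))

theorem tsum_norm_eq_sum {D : Set (G₁ × G₂)}
    (hR : ∀ st, st ∈ R ↔ st ∈ relevantPairs φ x y D) {z : G₁ × G₂} (hz : z ∈ D) (i : Fin r) :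
    ∑' st : I × I, ‖φ i (z.1 - x st.1, z.2 - y st.2)‖
      = ∑ st : R, ‖φ i (z - (x st.1.1, y st.1.2))‖ := by
  rw [tsum_eq_sum (s := R), ← Finset.sum_coe_sort]
  · rfl
  · intro st hst
    rw [norm_eq_zero]
    by_contra h
    exact hst ((hR st).2 ⟨z, hz, i, h⟩)

/-- A real supremum has junk value `0` on unbounded families, so boundedness must be shown; it holds
because the sums reduce to the finite set `R` and each `φ i` is bounded. -/
theorem sum_norm_le_supShiftSum (hφ : ∀ i, Continuous (φ i)) (hφc : ∀ i, HasCompactSupport (φ i))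
    {D : Set (G₁ × G₂)} (hR : ∀ st, st ∈ R ↔ st ∈ relevantPairs φ x y D) {z : G₁ × G₂}
    (hz : z ∈ D) :
    ∑ i, ∑ st : R, ‖φ i (z - (x st.1.1, y st.1.2))‖ ≤ supShiftSum φ x y D := by
  choose B hB using fun i => (hφc i).exists_bound_of_continuous (hφ i)
  have hbdd : BddAbove (Set.range fun z : D =>
      ∑ i, ∑' st : I × I, ‖φ i ((z : G₁ × G₂).1 - x st.1, (z : G₁ × G₂).2 - y st.2)‖) := by
    refine ⟨∑ i, ∑ _st : R, B i, ?_⟩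
    rintro _ ⟨z, rfl⟩
    simp only [tsum_norm_eq_sum hR z.2]
    gcongr
    exact hB _ _
  have h := le_ciSup hbdd ⟨z, hz⟩
  simp only [tsum_norm_eq_sum hR hz] at h
  exact h

theorem supShiftSum_nonneg (D : Set (G₁ × G₂)) : 0 ≤ supShiftSum φ x y D :=
  Real.iSup_nonneg fun _ => Finset.sum_nonneg fun _ _ => tsum_nonneg fun _ => norm_nonneg _

theorem norm_shiftCombination_le (hφ : ∀ i, Continuous (φ i))
    (hφc : ∀ i, HasCompactSupport (φ i)) {D : Set (G₁ × G₂)}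
    (hR : ∀ st, st ∈ R ↔ st ∈ relevantPairs φ x y D) (e : Fin r × R → ℂ) {z : G₁ × G₂}
    (hz : z ∈ D) : ‖shiftCombination φ x y R e z‖ ≤ supShiftSum φ x y D * ‖e‖ := by
  calc ‖shiftCombination φ x y R e z‖
      ≤ ∑ st : R, ∑ i, ‖e‖ * ‖φ i (z - (x st.1.1, y st.1.2))‖ := by
        refine (norm_sum_le _ _).trans (Finset.sum_le_sum fun st _ => (norm_sum_le _ _).trans
          (Finset.sum_le_sum fun i _ => ?_))
        rw [norm_mul]
        gcongr
        exact norm_le_pi_norm e (i, st)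
    _ = (∑ i, ∑ st : R, ‖φ i (z - (x st.1.1, y st.1.2))‖) * ‖e‖ := by
        rw [Finset.sum_comm, Finset.sum_mul]
        simp only [Finset.sum_mul, mul_comm]
    _ ≤ _ := by
        gcongr
        exact sum_norm_le_supShiftSum hφ hφc hR hz

end Topology

theorem seqNorm_extendCoeff_lt_top {p q : ℝ} (hp : 1 < p) (hq : 1 < q) (e : Fin r × R → ℂ)
    (i : Fin r) : seqNorm p q (extendCoeff R e i) < ∞ :=
  seqNorm_lt_top_of_finite hp hq R.finite_toSet fun s t h =>
    extendCoeff_of_notMem e i (by simpa using h)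

theorem norm_le_vecSeqNorm_extendCoeff {p q : ℝ} (hp : 1 < p) (hq : 1 < q) (e : Fin r × R → ℂ) :
    ENNReal.ofReal ‖e‖ ≤ vecSeqNorm p q (extendCoeff R e) := by
  have hfin : vecSeqNorm p q (extendCoeff R e) ≠ ∞ :=
    (ENNReal.sum_lt_top.2 fun i _ => seqNorm_extendCoeff_lt_top hp hq e i).ne
  rw [ENNReal.ofReal_le_iff_le_toReal hfin, pi_norm_le_iff_of_nonneg ENNReal.toReal_nonneg]
  rintro ⟨i, st⟩
  rw [← ENNReal.ofReal_le_iff_le_toReal hfin, ofReal_norm, ← extendCoeff_coe e i st]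
  exact (enorm_le_seqNorm hp hq _ _ _).trans
    (Finset.single_le_sum (f := fun i => seqNorm p q (extendCoeff R e i)) (fun _ _ => zero_le)
      (Finset.mem_univ i))

variable [MeasurableSpace G₁] [MeasurableSpace G₂] {μ₁ : Measure G₁} {μ₂ : Measure G₂}
  {D₁ : Set G₁} {D₂ : Set G₂} {p q a₁ a₂ : ℝ}

/-- Coefficients extended by zero off `R` satisfy the vanishing condition in the stability
assumption, and their sequence norm dominates the sup norm of `e`. -/
theorem HasStableShifts.le_mixedNorm
    (hstable : HasStableShifts p q μ₁ μ₂ D₁ D₂ φ x y a₁ a₂) (hp : 1 < p) (hq : 1 < q)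
    (hR : ∀ st, st ∈ R ↔ st ∈ relevantPairs φ x y (D₁ ×ˢ D₂)) (e : Fin r × R → ℂ) :
    ENNReal.ofReal a₁ * ENNReal.ofReal ‖e‖
      ≤ mixedNorm p q (μ₁.restrict D₁) (μ₂.restrict D₂) (shiftCombination φ x y R e) := by
  have h := (hstable (extendCoeff R e) (seqNorm_extendCoeff_lt_top hp hq e) ?_).1
  · rw [funext (shiftSum_extendCoeff (φ := φ) (x := x) (y := y) e)] at h
    exact (mul_le_mul' le_rfl (norm_le_vecSeqNorm_extendCoeff hp hq e)).trans h
  · intro s t hst i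
    refine extendCoeff_of_notMem e i fun hmem => ?_
    obtain ⟨z, hz, j, hj⟩ := (hR _).1 hmem
    exact hj (hst z hz j)

variable [TopologicalSpace G₁] [IsTopologicalAddGroup G₁] [T2Space G₁] [BorelSpace G₁]
  [TopologicalSpace G₂] [IsTopologicalAddGroup G₂] [T2Space G₂] [BorelSpace G₂]
  [IsFiniteMeasureOnCompacts μ₁] [IsFiniteMeasureOnCompacts μ₂]

theorem mixedNorm_lt_top_of_hasCompactSupport (hp : 0 < p) (hq : 0 < q) {F : G₁ × G₂ → ℂ}
    (hF : Continuous F) (hFc : HasCompactSupport F) : mixedNorm p q μ₁ μ₂ F < ∞ := by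
  obtain ⟨B, hB⟩ := hFc.exists_bound_of_continuous hF
  have h1 := hFc.isCompact.image continuous_fst
  have h2 := hFc.isCompact.image continuous_snd
  refine mixedNorm_le_of_bound hp hq h1.isClosed.measurableSet h2.isClosed.measurableSet
    h1.measure_lt_top.ne h2.measure_lt_top.ne (fun z hz => ?_) (L := ENNReal.ofReal B)
    ENNReal.ofReal_ne_top fun z => ?_
  · by_contra h
    have hz' : z ∈ tsupport F := subset_tsupport _ h
    exact hz ⟨Set.mem_image_of_mem _ hz', Set.mem_image_of_mem _ hz'⟩
  · rw [← ofReal_norm]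
    exact ENNReal.ofReal_le_ofReal (hB z)

theorem shiftCombination_mem_localSpace (hp : 1 < p) (hq : 1 < q) (hφ : ∀ i, Continuous (φ i))
    (hφc : ∀ i, HasCompactSupport (φ i)) (e : Fin r × R → ℂ) :
    shiftCombination φ x y R e ∈ localSpace p q μ₁ μ₂ D₁ D₂ φ x y :=
  ⟨(hasCompactSupport_shiftCombination hφc e).measurable_of_prod
      (continuous_shiftCombination hφ e),
    mixedNorm_lt_top_of_hasCompactSupport (by linarith) (by linarith)
      (continuous_shiftCombination hφ e) (hasCompactSupport_shiftCombination hφc e),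
    extendCoeff R e, seqNorm_extendCoeff_lt_top hp hq e,
    ae_of_all _ fun z => (shiftSum_extendCoeff e z).symm⟩

theorem exists_ae_eq_shiftCombination (hD₁ : IsCompact D₁) (hD₂ : IsCompact D₂)
    (hR : ∀ st, st ∈ R ↔ st ∈ relevantPairs φ x y (D₁ ×ˢ D₂)) {f : G₁ × G₂ → ℂ}
    (hf : f ∈ localSpace p q μ₁ μ₂ D₁ D₂ φ x y) :
    ∃ e : Fin r × R → ℂ, f =ᵐ[haarRect μ₁ μ₂ D₁ D₂] shiftCombination φ x y R e := by
  obtain ⟨-, -, c, -, hc⟩ := hf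
  refine ⟨fun ist => c ist.1 ist.2.1.1 ist.2.1.2, ?_⟩
  filter_upwards [hc, ae_haarRect_mem hD₁ hD₂] with z hz hzD
  rw [hz, shiftSum_eq_shiftCombination hR c hzD]

/-- Under stability, the coefficient vectors parametrise the local space. -/
theorem localDim_eq_finrank (hp : 1 < p) (hq : 1 < q) (hφ : ∀ i, Continuous (φ i))
    (hφc : ∀ i, HasCompactSupport (φ i)) (hD₁ : IsCompact D₁) (hD₂ : IsCompact D₂) (ha₁ : 0 < a₁)
    (hstable : HasStableShifts p q μ₁ μ₂ D₁ D₂ φ x y a₁ a₂)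
    (hR : ∀ st, st ∈ R ↔ st ∈ relevantPairs φ x y (D₁ ×ˢ D₂)) :
    localDim p q μ₁ μ₂ D₁ D₂ φ x y = Module.finrank ℝ (Fin r × R → ℂ) := by
  have hfin := isFiniteMeasure_restrict_of_isCompact μ₂ hD₂
  have hm : ∀ e : Fin r × R → ℂ,
      AEStronglyMeasurable (shiftCombination φ x y R e) (haarRect μ₁ μ₂ D₁ D₂) := fun e =>
    ((hasCompactSupport_shiftCombination hφc e).measurable_of_prod
      (continuous_shiftCombination hφ e)).aestronglyMeasurable
  let T : (Fin r × R → ℂ) →ₗ[ℝ] (G₁ × G₂ →ₘ[haarRect μ₁ μ₂ D₁ D₂] ℂ) :=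
    { toFun := fun e => AEEqFun.mk (shiftCombination φ x y R e) (hm e)
      map_add' := fun e e' => by
        rw [AEEqFun.mk_add_mk, AEEqFun.mk_eq_mk]
        exact ae_of_all _ (shiftCombination_add e e')
      map_smul' := fun a e => by
        rw [RingHom.id_apply, AEEqFun.smul_mk, AEEqFun.mk_eq_mk]
        refine ae_of_all _ fun z => ?_
        rw [shiftCombination_smul, Pi.smul_apply, Complex.real_smul] }
  -- A vector in the kernel gives a combination of mixed norm zero, which the lower stability bound
  -- excludes unless the vector is zero.
  have hT : Function.Injective T := by
    refine (injective_iff_map_eq_zero T).2 fun e he => ?_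
    have h0 : shiftCombination φ x y R e =ᵐ[haarRect μ₁ μ₂ D₁ D₂] fun _ => 0 := by
      change AEEqFun.mk _ (hm e) = 0 at he
      rw [AEEqFun.zero_def, AEEqFun.mk_eq_mk] at he
      exact he
    have h1 := hstable.le_mixedNorm hp hq hR e
    rw [mixedNorm_congr_ae h0] at h1
    rw [mixedNorm_zero (by linarith) (by linarith), nonpos_iff_eq_zero, mul_eq_zero,
      ENNReal.ofReal_eq_zero, ENNReal.ofReal_eq_zero] at h1
    rcases h1 with h1 | h1
    · linarith
    · exact norm_le_zero_iff.1 h1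
  have hrange : {F : (G₁ × G₂) →ₘ[haarRect μ₁ μ₂ D₁ D₂] ℂ |
      ∃ f ∈ localSpace p q μ₁ μ₂ D₁ D₂ φ x y, F =ᵐ[haarRect μ₁ μ₂ D₁ D₂] f}
      = (LinearMap.range T : Set _) := by
    ext F
    constructor
    · rintro ⟨f, hf, hFf⟩
      obtain ⟨e, he⟩ := exists_ae_eq_shiftCombination hD₁ hD₂ hR hf
      refine ⟨e, AEEqFun.ext ?_⟩
      exact (AEEqFun.coeFn_mk _ (hm e)).trans (he.symm.trans hFf.symm)
    · rintro ⟨e, rfl⟩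
      exact ⟨_, shiftCombination_mem_localSpace hp hq hφ hφc e, AEEqFun.coeFn_mk _ (hm e)⟩
  rw [localDim, hrange, Set.finrank, Submodule.span_eq, LinearMap.finrank_range_of_inj hT]

end Coefficients

/-! ### The explicit constants and the tail bound. -/

section Constants

variable {p q C₁ M₁ M₂ C w a γ ζ : ℝ}

/-- The deviation level `N_ζ`. -/
noncomputable def deviationLevel (p q C₁ M₁ M₂ C w a γ ζ : ℝ) : ℝ :=
  baseConst p q C₁ M₁ M₂ C w a γ * ζ ^ (p * q)

theorem deviationLevel_pos (hC₁ : 0 < C₁) (hM₁ : 0 < M₁) (hM₂ : 0 < M₂) (hC : 0 < C) (hw : 0 < w)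
    (ha : 0 < a) (hγ : 0 < γ) (hζ : 0 < ζ) : 0 < deviationLevel p q C₁ M₁ M₂ C w a γ ζ := by
  unfold deviationLevel baseConst
  positivity

/-- Expresses `T_ζ` through `N_ζ / L` with `L = C w / a`. After this substitution all powers of
`M₁`, `M₂` cancel from the two rates. -/
theorem rate_quantity_eq (hM₁ : 0 < M₁) (hM₂ : 0 < M₂) (hC : 0 < C) (hw : 0 < w)
    (ha : 0 < a) (hζ : 0 < ζ) :
    γ * C₁ * (a * ζ / (C * w)) ^ (p * q) = M₁ ^ (q - 1) * M₂ ^ (p - 1)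
      * (deviationLevel p q C₁ M₁ M₂ C w a γ ζ / (C / a * w)) := by
  unfold deviationLevel baseConst
  have h1 : a * ζ / (C * w) = ζ / (C / a * w) := by field_simp
  have hL : 0 < C / a * w := by positivity
  rw [h1, Real.div_rpow hζ.le hL.le, Real.rpow_sub hL, Real.rpow_one, ← neg_sub q 1, ← neg_sub p 1,
    Real.rpow_neg hM₁.le, Real.rpow_neg hM₂.le]
  field_simp

theorem rate₁_eq (hM₁ : 0 < M₁) (hM₂ : 0 < M₂) (hC : 0 < C) (hw : 0 < w)
    (ha : 0 < a) (hζ : 0 < ζ) {x : ℝ}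
    (hx : x = deviationLevel p q C₁ M₁ M₂ C w a γ ζ / (C / a * w)) (hx0 : 0 < x) :
    rate₁ p q C₁ M₁ M₂ C w a γ ζ = 3 / 4 * x ^ 2 / (6 + x) := by
  have hT := rate_quantity_eq (p := p) (q := q) (C₁ := C₁) (γ := γ) hM₁ hM₂ hC hw ha hζ
  rw [← hx] at hT
  have hT' : √3 / 2 * γ * C₁ * (a * ζ / (C * w)) ^ (p * q)
      = √3 / 2 * (M₁ ^ (q - 1) * M₂ ^ (p - 1) * x) := by rw [← hT]; ring
  have h3 : √3 ^ 2 = (3 : ℝ) := Real.sq_sqrt (by norm_num)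
  rw [rate₁, hT', hT, ← neg_sub q 1, ← neg_sub p 1, Real.rpow_neg hM₁.le, Real.rpow_neg hM₂.le]
  have e1 : 0 < M₁ ^ (q - 1) := by positivity
  have e2 : 0 < M₂ ^ (p - 1) := by positivity
  generalize M₁ ^ (q - 1) = A at *
  generalize M₂ ^ (p - 1) = B at *
  rw [mul_pow, div_pow, h3]
  have h6 : 6 * A * B + A * B * x = A * B * (6 + x) := by ring
  rw [h6]
  field_simp
  norm_num

theorem rate₂_eq (hM₁ : 0 < M₁) (hM₂ : 0 < M₂) (hC : 0 < C) (hw : 0 < w)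
    (ha : 0 < a) (hζ : 0 < ζ) {y : ℝ}
    (hy : y = deviationLevel p q C₁ M₁ M₂ C w a γ ζ / w) (hy0 : 0 < y) :
    rate₂ p q C₁ M₁ M₂ C w a γ ζ = y ^ 2 / (72 * √2 * (81 + y)) := by
  have hT := rate_quantity_eq (p := p) (q := q) (C₁ := C₁) (γ := γ) hM₁ hM₂ hC hw ha hζ
  have hT' : γ * C₁ * (a * ζ / (C * w)) ^ (p * q) * (C / a)
      = M₁ ^ (q - 1) * M₂ ^ (p - 1) * y := by
    rw [hT, hy]; field_simp
  rw [rate₂, hT', ← neg_sub q 1, ← neg_sub p 1, Real.rpow_neg hM₁.le, Real.rpow_neg hM₂.le]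
  have e1 : 0 < M₁ ^ (q - 1) := by positivity
  have e2 : 0 < M₂ ^ (p - 1) := by positivity
  generalize M₁ ^ (q - 1) = A at *
  generalize M₂ ^ (p - 1) = B at *
  have h6 : 81 * A * B + A * B * y = A * B * (81 + y) := by ring
  rw [h6]
  field_simp

/-- The denominator on the right is the second rate, so the assumption on `nm` says that `nm` times
this rate exceeds `3 d log 2`. -/
theorem sampleThreshold_eq {θ α : ℝ} (hθ : 0 < θ) (hα : 0 < α) (hw : 0 < w) (d : ℕ) {y : ℝ}
    (hy : y = deviationLevel p q C₁ M₁ M₂ C w a γ (θ / α) / w) (hy0 : 0 < y) :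
    sampleThreshold p q C₁ M₁ M₂ C w a γ θ α d
      = 3 * d * Real.log 2 / (y ^ 2 / (72 * √2 * (81 + y))) := by
  have hN : deviationLevel p q C₁ M₁ M₂ C w a γ (θ / α) = y * w := by rw [hy]; field_simp
  have hα' : 0 < α ^ (p * q) := by positivity
  have h1 : baseConst p q C₁ M₁ M₂ C w a γ * θ ^ (p * q) = y * w * α ^ (p * q) := by
    rw [← hN, deviationLevel, Real.div_rpow hθ.le hα.le]
    field_simp
  have h2 : 2 * baseConst p q C₁ M₁ M₂ C w a γ * (θ / α) ^ (p * q) = 2 * (y * w) := by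
    rw [← hN, deviationLevel]; ring
  have h3 : α ^ (2 * p * q) = (α ^ (p * q)) ^ 2 := by
    rw [← Real.rpow_natCast (α ^ (p * q)), ← Real.rpow_mul hα.le]
    congr 1
    push_cast
    ring
  rw [sampleThreshold, h1, h2, h3]
  generalize α ^ (p * q) = A at *
  field_simp
  ring

/-- The chaining bound, with coarsest scale `min (1/b) 4`, is dominated by the two stated
exponential terms. -/
theorem chaining_bound_le {d : ℕ} (hd : 1 ≤ d) {b S N : ℝ} (hb : 0 < b) (hS : 0 < S) (hN : 0 < N)
    (hw : 0 < w)
    (ht : 3 * d * Real.log 2 < S * ((N / w) ^ 2 / (72 * √2 * (81 + N / w)))) :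
    4 * d * Real.log 2 ≤ S * (N / (min (1 / b) 4 * (b * w))) ^ 2 / 128 ∧
    2 * (8 / min (1 / b) 4) ^ d * Real.exp (-(S * (N / (b * w)) ^ 2 / 2))
        + 4 * (8 / min (1 / b) 4) ^ (2 * d)
          * Real.exp (-(3 / 4 * (S * (N / (min (1 / b) 4 * (b * w))) ^ 2 / 128)))
      ≤ 2 * Real.exp (d * Real.log (8 * b))
          * Real.exp (-(S * (3 / 4 * (N / (b * w)) ^ 2 / (6 + N / (b * w)))))
        + 4 / (3 * d * Real.log 2 ^ 2) * (4 * b) ^ (2 * d)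
          * Real.exp (-(S * ((N / w) ^ 2 / (72 * √2 * (81 + N / w))))) := by
  set y := N / w with hy
  have hy0 : 0 < y := by positivity
  set t := S * (y ^ 2 / (72 * √2 * (81 + y))) with htdef
  have hl2 : 2 / 3 < Real.log 2 := by linarith [Real.log_two_gt_d9]
  have hl1 : Real.log 2 < 1 := by linarith [Real.log_two_lt_d9]
  have hd1 : (1 : ℝ) ≤ d := by exact_mod_cast hd
  have ht2d : 2 * (d : ℝ) ≤ t := by nlinarith
  have ht0 : 0 < t := by linarith
  -- Numerically `72 * √2 * 81 ≥ 63 * 128`: the Hoeffding exponent exceeds the stated one by a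
  -- factor `63`, which pays for all prefactors below.
  have hU : 63 * t ≤ S * y ^ 2 / 128 := by
    have h2 : (1.4 : ℝ) ≤ √2 := Real.le_sqrt_of_sq_le (by norm_num)
    have h3 : 63 * 128 ≤ 72 * √2 * (81 + y) := by nlinarith
    have h4 : y ^ 2 / (72 * √2 * (81 + y)) ≤ y ^ 2 / (63 * 128) := by gcongr
    calc 63 * t ≤ 63 * (S * (y ^ 2 / (63 * 128))) := by rw [htdef]; gcongr
      _ = _ := by ring
  have h4d : (2 : ℝ) ^ (2 * d) ≤ Real.exp t := by
    rw [← Real.rpow_natCast, Real.rpow_def_of_pos (by norm_num)]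
    refine Real.exp_le_exp.2 ?_
    push_cast
    nlinarith
  have hbx : N / (b * w) = y / b := by rw [hy]; field_simp
  have hdl : 3 * d * Real.log 2 ^ 2 ≤ t := by nlinarith
  have hdl0 : 0 < 3 * d * Real.log 2 ^ 2 := by positivity
  -- For `b ≥ 1/4` the scale `κ = 1/b` is admissible and turns `κ * (b * w)` into `w`. Otherwise `κ`
  -- is capped at `4`.
  rcases le_total (1 / 4) b with hb4 | hb4
  · have hmin : min (1 / b) 4 = 1 / b := min_eq_left (by
      rw [div_le_iff₀ hb]; linarith)
    have hκ : N / (1 / b * (b * w)) = y := by rw [hy]; field_simp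
    have h8 : 8 / (1 / b) = 8 * b := by field_simp
    rw [hmin, hκ, h8, hbx]
    refine ⟨by nlinarith, add_le_add ?_ ?_⟩
    · rw [← Real.log_pow, Real.exp_log (by positivity)]
      gcongr 2 * (8 * b) ^ d * Real.exp ?_
      have hx0 : 0 < y / b := by positivity
      have : 3 / 4 * (y / b) ^ 2 / (6 + y / b) ≤ (y / b) ^ 2 / 2 := by
        rw [div_le_div_iff₀ (by positivity) (by norm_num)]
        nlinarith [sq_nonneg (y / b), mul_pos (pow_pos hx0 2) hx0]
      have h9 := mul_le_mul_of_nonneg_left this hS.le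
      linarith
    -- Of a decay `exp (-3t)`, one factor absorbs `4^d`, one the denominator `3 d (log 2)^2`, and
    -- one is the stated exponential.
    · have h10 : (8 * b) ^ (2 * d) = (4 * b) ^ (2 * d) * 2 ^ (2 * d) := by
        rw [← mul_pow]; ring_nf
      have hexp : 3 * d * Real.log 2 ^ 2 ≤ Real.exp t :=
        hdl.trans (by linarith [Real.add_one_le_exp t])
      rw [h10]
      calc 4 * ((4 * b) ^ (2 * d) * 2 ^ (2 * d)) * Real.exp (-(3 / 4 * (S * y ^ 2 / 128)))
          ≤ 4 * ((4 * b) ^ (2 * d) * Real.exp t) * Real.exp (-(3 * t)) := by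
            gcongr 4 * ((4 * b) ^ (2 * d) * ?_) * Real.exp ?_
            linarith
        _ = 4 * (4 * b) ^ (2 * d) * Real.exp (-t) * (Real.exp t)⁻¹ := by
            rw [← Real.exp_neg, mul_assoc (4 * _), ← Real.exp_add, ← mul_assoc, mul_assoc,
              ← Real.exp_add]
            ring_nf
        _ ≤ 4 * (4 * b) ^ (2 * d) * Real.exp (-t) * (3 * d * Real.log 2 ^ 2)⁻¹ := by gcongr
        _ = _ := by ring
  · have hmin : min (1 / b) 4 = 4 := min_eq_right (by
      rw [le_div_iff₀ hb]; linarith)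
    have hκ : N / (4 * (b * w)) = y / (4 * b) := by rw [hy]; field_simp
    -- For small `b` the stated factor `(4b)^(2d) = v^(-d)` may be tiny. The exponents gain the same
    -- `v`, which compensates.
    set v := 1 / (4 * b) ^ 2 with hv
    have hv0 : 0 < v := by positivity
    have hv1 : 1 ≤ v := by
      rw [hv, one_le_div (by positivity)]
      nlinarith
    have hyv : (y / (4 * b)) ^ 2 = y ^ 2 * v := by rw [hv, div_pow]; ring
    have hyb : (y / b) ^ 2 = 16 * (y ^ 2 * v) := by rw [hv]; field_simp; norm_num
    have htv : t ≤ t * v := le_mul_of_one_le_right ht0.le hv1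
    have hUv : 63 * (t * v) ≤ S * (y ^ 2 * v) / 128 := by
      have := mul_le_mul_of_nonneg_right hU hv0.le
      linarith
    rw [hmin, hκ, hbx, hyv, hyb]
    refine ⟨by nlinarith, ?_⟩
    have hSv : 0 < S * (y ^ 2 * v) := by positivity
    -- The first stated term is discarded; the second alone dominates both chaining terms.
    refine le_add_of_nonneg_of_le (by positivity) ?_
    have h8 : (8 / 4 : ℝ) = 2 := by norm_num
    have h2d : (2 : ℝ) ^ d ≤ 2 ^ (2 * d) := pow_le_pow_right₀ (by norm_num) (by omega)
    have hvd : v ^ d ≤ Real.exp (t * v) := by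
      calc v ^ d ≤ (Real.exp v) ^ d := by
            gcongr
            linarith [Real.add_one_le_exp v]
        _ = Real.exp (d * v) := by rw [← Real.exp_nat_mul]
        _ ≤ Real.exp (t * v) := by
            refine Real.exp_le_exp.2 ?_
            gcongr
            linarith
    have hbv : (4 * b) ^ (2 * d) = (v ^ d)⁻¹ := by
      rw [hv, ← inv_pow, pow_mul]
      congr 1
      rw [one_div, inv_inv]
    have hexp : 3 * d * Real.log 2 ^ 2 ≤ Real.exp (t * v) :=
      (hdl.trans htv).trans (by linarith [Real.add_one_le_exp (t * v)])
    have hsix : (3 / 2 : ℝ) ≤ Real.exp (t * v) := by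
      linarith [Real.add_one_le_exp (t * v)]
    rw [h8]
    have hX1 : Real.exp (-(S * (16 * (y ^ 2 * v)) / 2)) ≤ Real.exp (-(6 * (t * v))) :=
      Real.exp_le_exp.2 (by linarith)
    have hX2 : Real.exp (-(3 / 4 * (S * (y ^ 2 * v) / 128))) ≤ Real.exp (-(6 * (t * v))) :=
      Real.exp_le_exp.2 (by linarith [mul_pos ht0 hv0])
    have h4dv : (2 : ℝ) ^ (2 * d) ≤ Real.exp (t * v) := h4d.trans (Real.exp_le_exp.2 htv)
    -- After paying for `4^d` and the factor `3/2`, three factors `exp (-t v)` are kept: one each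
    -- for `3 d (log 2)^2`, for `v^d`, and for the stated exponential.
    have hthird : Real.exp (t * v) * (Real.exp (t * v) * Real.exp (-(6 * (t * v))))
        ≤ Real.exp (-(t * v)) * (Real.exp (-(t * v)) * Real.exp (-(t * v))) := by
      simp only [← Real.exp_add]
      exact Real.exp_le_exp.2 (by linarith [mul_pos ht0 hv0])
    have hi1 : Real.exp (-(t * v)) ≤ (3 * d * Real.log 2 ^ 2)⁻¹ := by
      rw [Real.exp_neg]; exact inv_anti₀ hdl0 hexp
    have hi2 : Real.exp (-(t * v)) ≤ (v ^ d)⁻¹ := by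
      rw [Real.exp_neg]; exact inv_anti₀ (by positivity) hvd
    have hi3 : Real.exp (-(t * v)) ≤ Real.exp (-t) := Real.exp_le_exp.2 (by linarith)
    calc 2 * 2 ^ d * Real.exp (-(S * (16 * (y ^ 2 * v)) / 2))
          + 4 * 2 ^ (2 * d) * Real.exp (-(3 / 4 * (S * (y ^ 2 * v) / 128)))
        ≤ 2 * Real.exp (t * v) * Real.exp (-(6 * (t * v)))
          + 4 * Real.exp (t * v) * Real.exp (-(6 * (t * v))) :=
          add_le_add
            (mul_le_mul (mul_le_mul_of_nonneg_left (h2d.trans h4dv) (by norm_num)) hX1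
              (Real.exp_nonneg _) (by positivity))
            (mul_le_mul (mul_le_mul_of_nonneg_left h4dv (by norm_num)) hX2
              (Real.exp_nonneg _) (by positivity))
      _ = 4 * (3 / 2 * (Real.exp (t * v) * Real.exp (-(6 * (t * v))))) := by ring
      _ ≤ 4 * (Real.exp (t * v) * (Real.exp (t * v) * Real.exp (-(6 * (t * v))))) :=
          mul_le_mul_of_nonneg_left (mul_le_mul_of_nonneg_right hsix (by positivity)) (by norm_num)
      _ ≤ 4 * (Real.exp (-(t * v)) * (Real.exp (-(t * v)) * Real.exp (-(t * v)))) :=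
          mul_le_mul_of_nonneg_left hthird (by norm_num)
      _ ≤ 4 * ((3 * d * Real.log 2 ^ 2)⁻¹ * ((v ^ d)⁻¹ * Real.exp (-t))) :=
          mul_le_mul_of_nonneg_left (mul_le_mul hi1 (mul_le_mul hi2 hi3 (Real.exp_nonneg _)
            (by positivity)) (by positivity) (by positivity)) (by norm_num)
      _ = _ := by rw [hbv]; ring

end Constants

/-! ### From `ℓ¹` deviation to the two sampling bounds. -/

section RealEstimates

variable {p q C₁ C₂ M₁ M₂ C w a γ θ α A I J S σ : ℝ} {n m : ℕ}

/-- Here `A` plays the role of `‖f‖`, `I` of the Haar integral and `J` of the expectation of `|f *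
ω|`, `S` of the sample `ℓ¹` sum and `σ` of the sample mixed norm. With `N = γ Λ`, the inequality
`hI` gives `J ≥ A Λ`, so a share `(1 - γ) A Λ` survives the deviation. -/
theorem lowerBound_mul_le (hC₁ : 0 < C₁) (hM₁ : 0 < M₁) (hM₂ : 0 < M₂) (hC : 0 < C) (hw : 0 < w)
    (ha : 0 < a) (hθ : 0 < θ) (hA : 0 < A) (hAα : A ≤ α) (hp : 1 < p)
    (hq : 1 < q) (hn : 0 < n) (hm : 0 < m)
    (hI : θ ^ (p * q) ≤ M₁ ^ (q - 1) * M₂ ^ (p - 1) * (C / a * w * A) ^ (p * q - 1) * I)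
    (hJ : C₁ * I ≤ J)
    (hS : n * m * (J - A * deviationLevel p q C₁ M₁ M₂ C w a γ (θ / α)) ≤ S)
    (hσ : S ≤ (n : ℝ) ^ ((p - 1) / p) * (m : ℝ) ^ ((q - 1) / q) * σ) :
    lowerBound p q C₁ M₁ M₂ C w a γ (θ / α) n m * A ≤ σ := by
  have hα : 0 < α := hA.trans_le hAα
  have hL : 0 < C / a * w := by positivity
  have hpq : 0 < p * q := by nlinarith
  have hn' : (0 : ℝ) < n := by exact_mod_cast hn
  have hm' : (0 : ℝ) < m := by exact_mod_cast hm
  set Λ := C₁ * M₁ ^ (1 - q) * M₂ ^ (1 - p) * (C / a * w) ^ (1 - p * q) * (θ / α) ^ (p * q) with hΛ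
  have hΛ0 : 0 < Λ := by positivity
  have hdev : deviationLevel p q C₁ M₁ M₂ C w a γ (θ / α) = γ * Λ := by
    rw [deviationLevel, baseConst, hΛ]; ring
  have hpow : (C / a * w * A) ^ (p * q - 1) = ((C / a * w) ^ (1 - p * q))⁻¹ * A ^ (p * q) / A := by
    rw [Real.mul_rpow hL.le hA.le, Real.rpow_sub hA, Real.rpow_one, ← neg_sub (p * q) 1,
      Real.rpow_neg hL.le, inv_inv]
    ring
  have hinv₁ : M₁ ^ (q - 1) = (M₁ ^ (1 - q))⁻¹ := by
    rw [← Real.rpow_neg hM₁.le, neg_sub]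
  have hinv₂ : M₂ ^ (p - 1) = (M₂ ^ (1 - p))⁻¹ := by
    rw [← Real.rpow_neg hM₂.le, neg_sub]
  rw [hpow, hinv₁, hinv₂] at hI
  have h1 : A * Λ ≤ C₁ * I := by
    -- The only use of `A ≤ α`: it makes the bound uniform over the class.
    have h2 : (θ / α) ^ (p * q) ≤ θ ^ (p * q) / A ^ (p * q) := by
      rw [← Real.div_rpow hθ.le hA.le]
      gcongr
    have e1 : 0 < M₁ ^ (1 - q) := by positivity
    have e2 : 0 < M₂ ^ (1 - p) := by positivity
    have e3 : 0 < (C / a * w) ^ (1 - p * q) := by positivity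
    have e4 : 0 < A ^ (p * q) := by positivity
    rw [hΛ]
    generalize M₁ ^ (1 - q) = m₁ at *
    generalize M₂ ^ (1 - p) = m₂ at *
    generalize (C / a * w) ^ (1 - p * q) = l at *
    generalize A ^ (p * q) = B at *
    calc A * (C₁ * m₁ * m₂ * l * (θ / α) ^ (p * q))
        ≤ A * (C₁ * m₁ * m₂ * l * (m₁⁻¹ * m₂⁻¹ * (l⁻¹ * B / A) * I / B)) := by
          gcongr
          exact h2.trans (by gcongr)
      _ = C₁ * I := by field_simp
  have h3 : n * m * (A * ((1 - γ) * Λ)) ≤ S := by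
    refine le_trans ?_ hS
    rw [hdev]
    gcongr
    linarith
  have h4 : (n : ℝ) = (n : ℝ) ^ ((p - 1) / p) * (n : ℝ) ^ (1 / p) := by
    rw [← Real.rpow_add hn', ← add_div, sub_add_cancel, div_self (by linarith), Real.rpow_one]
  have h5 : (m : ℝ) = (m : ℝ) ^ ((q - 1) / q) * (m : ℝ) ^ (1 / q) := by
    rw [← Real.rpow_add hm', ← add_div, sub_add_cancel, div_self (by linarith), Real.rpow_one]
  have h6 : lowerBound p q C₁ M₁ M₂ C w a γ (θ / α) n m
      = (1 - γ) * Λ * (n : ℝ) ^ (1 / p) * (m : ℝ) ^ (1 / q) := by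
    rw [lowerBound, hΛ, show C * w / a = C / a * w by ring]
    ring
  have e5 : 0 < (n : ℝ) ^ ((p - 1) / p) := by positivity
  have e6 : 0 < (m : ℝ) ^ ((q - 1) / q) := by positivity
  rw [h6]
  refine le_of_mul_le_mul_left ?_ (mul_pos e5 e6)
  refine le_trans (le_of_eq ?_) (h3.trans hσ)
  conv_rhs => rw [h4, h5]
  ring

theorem le_upperBound_mul (hJ : J ≤ C₂ * I)
    (hI : I ≤ M₁ ^ ((p - 1) / p) * M₂ ^ ((q - 1) / q) * w * A) (hC₂ : 0 ≤ C₂)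
    (hS : S ≤ n * m * (J + A * deviationLevel p q C₁ M₁ M₂ C w a γ (θ / α)))
    (hσ : σ ≤ S) :
    σ ≤ upperBound p q C₁ C₂ M₁ M₂ C w a γ (θ / α) n m * A := by
  have h1 : J ≤ C₂ * (M₁ ^ ((p - 1) / p) * M₂ ^ ((q - 1) / q) * w * A) :=
    hJ.trans (by gcongr)
  refine hσ.trans (hS.trans ?_)
  calc (n : ℝ) * m * (J + A * deviationLevel p q C₁ M₁ M₂ C w a γ (θ / α))
      ≤ n * m * (C₂ * (M₁ ^ ((p - 1) / p) * M₂ ^ ((q - 1) / q) * w * A)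
          + A * deviationLevel p q C₁ M₁ M₂ C w a γ (θ / α)) := by gcongr
    _ = _ := by
      rw [upperBound, deviationLevel, baseConst, show C * w / a = C / a * w by ring]
      ring

end RealEstimates

/-! ### Averages of the finite combinations. -/

section LocalConvolution

variable {G₁ G₂ I : Type*}
  [AddCommGroup G₁] [TopologicalSpace G₁] [IsTopologicalAddGroup G₁] [T2Space G₁]
  [MeasurableSpace G₁] [BorelSpace G₁]
  [AddCommGroup G₂] [TopologicalSpace G₂] [IsTopologicalAddGroup G₂] [T2Space G₂]
  [MeasurableSpace G₂] [BorelSpace G₂]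
  {μ₁ : Measure G₁} {μ₂ : Measure G₂}
  [IsFiniteMeasureOnCompacts μ₁] [IsFiniteMeasureOnCompacts μ₂]
  {W₁ : Set G₁} {W₂ : Set G₂} {ω : G₁ × G₂ → ℂ} {K₁ : Set G₁} {K₂ : Set G₂}
  {r : ℕ} {φ : Fin r → G₁ × G₂ → ℂ} {x : I → G₁} {y : I → G₂} {R : Finset (I × I)}

/-- The averages `F_e * ω` of the finite combinations of shifts, cut off to `K`. -/
noncomputable def localAverage (μ₁ : Measure G₁) (μ₂ : Measure G₂) (ω : G₁ × G₂ → ℂ) (K₁ : Set G₁)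
    (K₂ : Set G₂) (φ : Fin r → G₁ × G₂ → ℂ) (x : I → G₁) (y : I → G₂) (R : Finset (I × I))
    (e : Fin r × R → ℂ) : G₁ × G₂ → ℂ :=
  (K₁ ×ˢ K₂).indicator (conv μ₁ μ₂ (shiftCombination φ x y R e) ω)

theorem measurable_localAverage (hW₁ : IsCompact W₁) (hW₂ : IsCompact W₂)
    (hω : Function.support ω ⊆ W₁ ×ˢ W₂) (hωi : Integrable ω (haarRect μ₁ μ₂ W₁ W₂))
    (hK₁ : IsCompact K₁) (hK₂ : IsCompact K₂) (hφ : ∀ i, Continuous (φ i))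
    (hφc : ∀ i, HasCompactSupport (φ i)) (e : Fin r × R → ℂ) :
    Measurable (localAverage μ₁ μ₂ ω K₁ K₂ φ x y R e) :=
  (measurable_conv hW₁ hW₂ hω hωi (continuous_shiftCombination hφ e)
    (hasCompactSupport_shiftCombination hφc e)).indicator
    (hK₁.isClosed.measurableSet.prod hK₂.isClosed.measurableSet)

theorem localAverage_add_smul (hW₁ : IsCompact W₁) (hW₂ : IsCompact W₂)
    (hω : Function.support ω ⊆ W₁ ×ˢ W₂) (hωi : Integrable ω (haarRect μ₁ μ₂ W₁ W₂))
    (hφ : ∀ i, Continuous (φ i)) (hφc : ∀ i, HasCompactSupport (φ i)) (e e' : Fin r × R → ℂ)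
    (a : ℝ) (z : G₁ × G₂) :
    localAverage μ₁ μ₂ ω K₁ K₂ φ x y R (e + a • e') z
      = localAverage μ₁ μ₂ ω K₁ K₂ φ x y R e z
        + a * localAverage μ₁ μ₂ ω K₁ K₂ φ x y R e' z := by
  by_cases hz : z ∈ K₁ ×ˢ K₂
  · have hm : ∀ e : Fin r × R → ℂ, Measurable (shiftCombination φ x y R e) := fun e =>
      (hasCompactSupport_shiftCombination hφc e).measurable_of_prod
        (continuous_shiftCombination hφ e)
    choose B hB using fun e : Fin r × R → ℂ =>
      (hasCompactSupport_shiftCombination hφc e).exists_bound_of_continuous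
        (continuous_shiftCombination (x := x) (y := y) hφ e)
    simp only [localAverage, Set.indicator_of_mem hz]
    rw [conv_eq_integral_haarRect hW₁ hW₂ hω hωi (hm _) (hB _),
      conv_eq_integral_haarRect hW₁ hW₂ hω hωi (hm _) (hB _),
      conv_eq_integral_haarRect hW₁ hW₂ hω hωi (hm _) (hB _), ← integral_const_mul,
      ← integral_add (integrable_comp_sub_mul hωi (hm _) (hB _) z)
        ((integrable_comp_sub_mul hωi (hm _) (hB _) z).const_mul _)]
    congr 1
    funext w
    rw [shiftCombination_add, shiftCombination_smul]
    ring
  · simp [localAverage, Set.indicator_of_notMem hz]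

theorem norm_localAverage_le (hW₁ : IsCompact W₁) (hW₂ : IsCompact W₂)
    (hω : Function.support ω ⊆ W₁ ×ˢ W₂) (hωi : Integrable ω (haarRect μ₁ μ₂ W₁ W₂))
    (hφ : ∀ i, Continuous (φ i)) (hφc : ∀ i, HasCompactSupport (φ i))
    (hR : ∀ st, st ∈ R ↔ st ∈ relevantPairs φ x y ((K₁ - W₁) ×ˢ (K₂ - W₂))) (e : Fin r × R → ℂ)
    (z : G₁ × G₂) :
    ‖localAverage μ₁ μ₂ ω K₁ K₂ φ x y R e z‖
      ≤ supShiftSum φ x y ((K₁ - W₁) ×ˢ (K₂ - W₂)) * ‖e‖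
        * ∫ w, ‖ω w‖ ∂(haarRect μ₁ μ₂ W₁ W₂) := by
  by_cases hz : z ∈ K₁ ×ˢ K₂
  · obtain ⟨B, hB⟩ := (hasCompactSupport_shiftCombination hφc e).exists_bound_of_continuous
      (continuous_shiftCombination (x := x) (y := y) hφ e)
    rw [localAverage, Set.indicator_of_mem hz]
    exact norm_conv_le hW₁ hW₂ hω hωi ((hasCompactSupport_shiftCombination hφc e).measurable_of_prod
      (continuous_shiftCombination hφ e)) hB fun w hw => norm_shiftCombination_le hφ hφc hR e
        ⟨Set.sub_mem_sub hz.1 hw.1, Set.sub_mem_sub hz.2 hw.2⟩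
  · rw [localAverage, Set.indicator_of_notMem hz, norm_zero]
    have := supShiftSum_nonneg (φ := φ) (x := x) (y := y) ((K₁ - W₁) ×ˢ (K₂ - W₂))
    positivity

/-- A member of the local class is represented by a nonzero coefficient vector. -/
theorem exists_coeff_of_mem_localClass [LocallyCompactSpace G₁] [LocallyCompactSpace G₂]
    [μ₁.IsAddHaarMeasure] [μ₁.Regular] [μ₂.IsAddHaarMeasure] [μ₂.Regular] {p q : ℝ} (hp : 1 < p)
    (hq : 1 < q)
    (hW₁ : IsCompact W₁) (hW₂ : IsCompact W₂)
    (hω : Function.support ω ⊆ W₁ ×ˢ W₂)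
    (hK₁ : IsCompact K₁) (hK₂ : IsCompact K₂) {a₁ a₂ : ℝ} (ha₁ : 0 < a₁)
    (hstable : HasStableShifts p q μ₁ μ₂ (K₁ - W₁) (K₂ - W₂) φ x y a₁ a₂)
    (hR : ∀ st, st ∈ R ↔ st ∈ relevantPairs φ x y ((K₁ - W₁) ×ˢ (K₂ - W₂)))
    {θ α : ℝ} (hα : 0 < α) {f : G₁ × G₂ → ℂ}
    (hf : f ∈ localClass p q μ₁ μ₂ K₁ W₁ K₂ W₂ φ x y ω θ α) {A : ℝ}
    (hA : A = (mixedNorm p q (μ₁.restrict (K₁ - W₁)) (μ₂.restrict (K₂ - W₂)) f).toReal) :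
    ∃ e : Fin r × R → ℂ,
      mixedNorm p q (μ₁.restrict (K₁ - W₁)) (μ₂.restrict (K₂ - W₂)) (shiftCombination φ x y R e)
        = ENNReal.ofReal A ∧
      a₁ * ‖e‖ ≤ A ∧ A ≤ α ∧
      (∀ z ∈ K₁ ×ˢ K₂, conv μ₁ μ₂ f ω z = localAverage μ₁ μ₂ ω K₁ K₂ φ x y R e z) ∧
      ENNReal.ofReal θ ≤ mixedNorm p q (μ₁.restrict K₁) (μ₂.restrict K₂)
        (localAverage μ₁ μ₂ ω K₁ K₂ φ x y R e) := by
  obtain ⟨hloc, hθ, hα'⟩ := hf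
  have hD₁ := isCompact_sub hK₁ hW₁
  have hD₂ := isCompact_sub hK₂ hW₂
  have := isFiniteMeasure_restrict_of_isCompact μ₂ hD₂
  obtain ⟨e, he⟩ := exists_ae_eq_shiftCombination hD₁ hD₂ hR hloc
  have hnorm : mixedNorm p q (μ₁.restrict (K₁ - W₁)) (μ₂.restrict (K₂ - W₂))
      (shiftCombination φ x y R e) = ENNReal.ofReal A := by
    rw [hA, ENNReal.ofReal_toReal (ne_top_of_le_ne_top ENNReal.ofReal_ne_top hα')]
    exact (mixedNorm_congr_ae he).symm
  have hA0 : 0 ≤ A := hA ▸ ENNReal.toReal_nonneg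
  have hconv : ∀ z ∈ K₁ ×ˢ K₂,
      conv μ₁ μ₂ f ω z = localAverage μ₁ μ₂ ω K₁ K₂ φ x y R e z := fun z hz => by
    rw [localAverage, Set.indicator_of_mem hz]
    exact conv_congr_ae hK₁ hK₂ hW₁ hW₂ hω he hz
  refine ⟨e, hnorm, ?_, hA ▸ ENNReal.toReal_le_of_le_ofReal hα.le hα', hconv, ?_⟩
  · have h := hstable.le_mixedNorm hp hq hR e
    rwa [hnorm, ← ENNReal.ofReal_mul ha₁.le, ENNReal.ofReal_le_ofReal_iff hA0] at h
  · rwa [← mixedNorm_congr_rect hK₁.isClosed.measurableSet hK₂.isClosed.measurableSet hconv]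

end LocalConvolution

/-- Serves the case of an empty class, where the signs of the constants are unknown; the even
exponent `2 * d` keeps the second prefactor nonnegative. -/
theorem sub_prefactor_le_one {C a s t : ℝ} {d : ℕ} :
    1 - prefactor₁ C a d * Real.exp s - prefactor₂ C a d * Real.exp t ≤ 1 := by
  have h1 : 0 ≤ prefactor₁ C a d := by unfold prefactor₁; positivity
  have h2 : 0 ≤ prefactor₂ C a d := by
    unfold prefactor₂
    have : 0 ≤ (4 * C / a) ^ (2 * d) := by rw [pow_mul]; positivity
    positivity
  have h3 := mul_nonneg h1 (Real.exp_nonneg s)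
  have h4 := mul_nonneg h2 (Real.exp_nonneg t)
  linarith

end RandomAverageSampling

/-! ### The sampling inequality. -/

theorem theorem3p2
    {G₁ G₂ : Type*}
    [AddCommGroup G₁] [TopologicalSpace G₁] [IsTopologicalAddGroup G₁] [LocallyCompactSpace G₁]
    [T2Space G₁] [MeasurableSpace G₁] [BorelSpace G₁]
    [AddCommGroup G₂] [TopologicalSpace G₂] [IsTopologicalAddGroup G₂] [LocallyCompactSpace G₂]
    [T2Space G₂] [MeasurableSpace G₂] [BorelSpace G₂]
    (μ₁ : Measure G₁) [μ₁.IsAddHaarMeasure] [μ₁.Regular]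
    (μ₂ : Measure G₂) [μ₂.IsAddHaarMeasure] [μ₂.Regular]
    (p q : ℝ) (hp : 1 < p) (hq : 1 < q)
    -- the separated families of translates
    {I : Type*} [Countable I] (x : I → G₁) (y : I → G₂)
    (hx : IsSeparatedFamily x) (hy : IsSeparatedFamily y)
    -- the averaging function
    (W₁ : Set G₁) (W₂ : Set G₂) (hW₁ : IsCompact W₁) (hW₂ : IsCompact W₂)
    (h0W₁ : (0 : G₁) ∈ W₁) (h0W₂ : (0 : G₂) ∈ W₂)
    (ω : G₁ × G₂ → ℂ) (hω_supp : Function.support ω ⊆ W₁ ×ˢ W₂)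
    (hω_int : Integrable ω (haarRect μ₁ μ₂ W₁ W₂))
    -- the sampling domain, the generators and their stability
    (K₁ : Set G₁) (K₂ : Set G₂) (hK₁ : IsCompact K₁) (hK₂ : IsCompact K₂)
    {r : ℕ} (φ : Fin r → G₁ × G₂ → ℂ)
    (hφ_cont : ∀ i, Continuous (φ i)) (hφ_supp : ∀ i, HasCompactSupport (φ i))
    (a₁ a₂ : ℝ) (ha₁ : 0 < a₁) (ha₁₂ : a₁ ≤ a₂)
    (hstable : HasStableShifts p q μ₁ μ₂ (K₁ - W₁) (K₂ - W₂) φ x y a₁ a₂)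
    -- sequential compactness
    (hseq : IsSeqCompact (((K₁ - W₁) ×ˢ (K₂ - W₂)) - ⋃ i, tsupport (φ i)))
    -- the probability density on `K₁ × K₂`
    (ρ : G₁ × G₂ → ℝ) (C₁ C₂ : ℝ) (hC₁ : 0 < C₁)
    (hρ_meas : AEMeasurable ρ (haarRect μ₁ μ₂ K₁ K₂))
    (hρ_bound : ∀ z ∈ K₁ ×ˢ K₂, C₁ ≤ ρ z ∧ ρ z ≤ C₂)
    (hρ_int : ∫ z, ρ z ∂(haarRect μ₁ μ₂ K₁ K₂) = 1)
    -- the i.i.d. sample points; `X j k` is the point written `(u_j, v_k)`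
    {Ω : Type*} [MeasurableSpace Ω] (P : Measure Ω) [IsProbabilityMeasure P]
    (X : ℕ → ℕ → Ω → G₁ × G₂)
    (hX_law : ∀ j k, HasLaw (X j k)
      ((haarRect μ₁ μ₂ K₁ K₂).withDensity fun z => ENNReal.ofReal (ρ z)) P)
    (hX_indep : iIndepFun (fun jk : ℕ × ℕ => X jk.1 jk.2) P)
    -- the parameters
    (θ α γ : ℝ) (hθ : 0 < θ) (hα : 0 < α) (hγ₀ : 0 < γ) (hγ₁ : γ < 1)
    -- abbreviations for the quantities that enter the constants
    (M₁ M₂ w C : ℝ) (d : ℕ)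
    (hM₁ : M₁ = μ₁.real K₁) (hM₂ : M₂ = μ₂.real K₂)
    (hw : w = ∫ z, ‖ω z‖ ∂(haarRect μ₁ μ₂ W₁ W₂))
    (hC : C = supShiftSum φ x y ((K₁ - W₁) ×ˢ (K₂ - W₂)))
    (hd : d = localDim p q μ₁ μ₂ (K₁ - W₁) (K₂ - W₂) φ x y)
    -- the number of samples
    (n m : ℕ)
    (hnm : sampleThreshold p q C₁ M₁ M₂ C w a₁ γ θ α d < (n : ℝ) * m) :
    ∃ E : Set Ω, MeasurableSet E ∧
      1 - prefactor₁ C a₁ d * Real.exp (-(n * m * rate₁ p q C₁ M₁ M₂ C w a₁ γ (θ / α)))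
          - prefactor₂ C a₁ d * Real.exp (-(n * m * rate₂ p q C₁ M₁ M₂ C w a₁ γ (θ / α)))
        ≤ P.real E ∧
      ∀ η ∈ E, ∀ f ∈ localClass p q μ₁ μ₂ K₁ W₁ K₂ W₂ φ x y ω θ α,
        lowerBound p q C₁ M₁ M₂ C w a₁ γ (θ / α) n m
            * (mixedNorm p q (μ₁.restrict (K₁ - W₁)) (μ₂.restrict (K₂ - W₂)) f).toReal
          ≤ (seqNorm p q fun (j : Fin n) (k : Fin m) => conv μ₁ μ₂ f ω (X j k η)).toReal ∧
        (seqNorm p q fun (j : Fin n) (k : Fin m) => conv μ₁ μ₂ f ω (X j k η)).toReal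
          ≤ upperBound p q C₁ C₂ M₁ M₂ C w a₁ γ (θ / α) n m
            * (mixedNorm p q (μ₁.restrict (K₁ - W₁)) (μ₂.restrict (K₂ - W₂)) f).toReal := by
  classical
  have hD₁ := isCompact_sub hK₁ hW₁
  have hD₂ := isCompact_sub hK₂ hW₂
  have hfinite := finite_relevantPairs hφ_supp hx hy hD₁ hD₂
  set R := hfinite.toFinset with hRdef
  have hR : ∀ st, st ∈ R ↔ st ∈ relevantPairs φ x y ((K₁ - W₁) ×ˢ (K₂ - W₂)) := fun st =>
    hfinite.mem_toFinset
  have hdim : d = Module.finrank ℝ (Fin r × R → ℂ) :=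
    hd.trans (localDim_eq_finrank hp hq hφ_cont hφ_supp hD₁ hD₂ ha₁ hstable hR)
  rcases (localClass p q μ₁ μ₂ K₁ W₁ K₂ W₂ φ x y ω θ α).eq_empty_or_nonempty with hempty | hne
  · refine ⟨Set.univ, MeasurableSet.univ, ?_, fun η _ f hf => absurd hf (by simp [hempty])⟩
    rw [probReal_univ]
    exact sub_prefactor_le_one
  have hp0 : 0 < p := by linarith
  have hq0 : 0 < q := by linarith
  have := isFiniteMeasure_restrict_of_isCompact μ₁ hK₁
  have := isFiniteMeasure_restrict_of_isCompact μ₂ hK₂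
  have := isFiniteMeasure_haarRect (μ₁ := μ₁) (μ₂ := μ₂) hK₁ hK₂
  have hM₁' : ENNReal.ofReal M₁ = μ₁ K₁ := by
    rw [hM₁]; exact ENNReal.ofReal_toReal hK₁.measure_lt_top.ne
  have hM₂' : ENNReal.ofReal M₂ = μ₂ K₂ := by
    rw [hM₂]; exact ENNReal.ofReal_toReal hK₂.measure_lt_top.ne
  -- A null `K₁` could not carry a density of integral one.
  have hM₁0 : 0 < M₁ := by
    by_contra h
    have h0 : μ₁ K₁ = 0 := by rw [← hM₁', ENNReal.ofReal_eq_zero]; linarith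
    have h1 : haarRect μ₁ μ₂ K₁ K₂ = 0 := by
      rw [haarRect, Measure.restrict_eq_zero.2 h0, Measure.zero_prod]
    rw [h1] at hρ_int
    simp at hρ_int
  have hM₂0 : 0 < M₂ := by
    by_contra h
    have h0 : μ₂ K₂ = 0 := by rw [← hM₂', ENNReal.ofReal_eq_zero]; linarith
    have h1 : haarRect μ₁ μ₂ K₁ K₂ = 0 := by
      rw [haarRect, Measure.restrict_eq_zero.2 h0, Measure.prod_zero]
    rw [h1] at hρ_int
    simp at hρ_int
  let g : (Fin r × R → ℂ) → G₁ × G₂ → ℂ := localAverage μ₁ μ₂ ω K₁ K₂ φ x y R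
  have hgm : ∀ e, Measurable (g e) :=
    measurable_localAverage hW₁ hW₂ hω_supp hω_int hK₁ hK₂ hφ_cont hφ_supp
  have hglin : ∀ e e' (a : ℝ) z, g (e + a • e') z = g e z + a * g e' z :=
    localAverage_add_smul hW₁ hW₂ hω_supp hω_int hφ_cont hφ_supp
  have hgle : ∀ e z, ‖g e z‖ ≤ C * ‖e‖ * w := fun e z => by
    rw [hC, hw]
    exact norm_localAverage_le hW₁ hW₂ hω_supp hω_int hφ_cont hφ_supp hR e z
  have hg0 : ∀ z, g 0 z = 0 := fun z => by
    have := hgle 0 z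
    rw [norm_zero, mul_zero, zero_mul] at this
    exact norm_le_zero_iff.1 this
  have hgsmul : ∀ (a : ℝ) e z, g (a • e) z = a * g e z := fun a e z => by
    have := hglin 0 e a z
    rwa [zero_add, hg0, zero_add] at this
  have hC0 : 0 ≤ C := by rw [hC]; exact supShiftSum_nonneg _
  have hw0 : 0 ≤ w := by rw [hw]; positivity
  have hrep : ∀ f ∈ localClass p q μ₁ μ₂ K₁ W₁ K₂ W₂ φ x y ω θ α, ∀ A : ℝ,
      A = (mixedNorm p q (μ₁.restrict (K₁ - W₁)) (μ₂.restrict (K₂ - W₂)) f).toReal →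
      ∃ e : Fin r × R → ℂ,
      mixedNorm p q (μ₁.restrict (K₁ - W₁)) (μ₂.restrict (K₂ - W₂)) (shiftCombination φ x y R e)
        = ENNReal.ofReal A ∧
      a₁ * ‖e‖ ≤ A ∧ A ≤ α ∧ (∀ z ∈ K₁ ×ˢ K₂, conv μ₁ μ₂ f ω z = g e z) ∧
      ENNReal.ofReal θ ≤ mixedNorm p q (μ₁.restrict K₁) (μ₂.restrict K₂) (g e) ∧
      0 < C * ‖e‖ * w := by
    intro f hf A hA
    obtain ⟨e, h1, h2, h3, h4, h5⟩ := exists_coeff_of_mem_localClass hp hq hW₁ hW₂ hω_supp hK₁ hK₂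
      ha₁ hstable hR hα hf hA
    refine ⟨e, h1, h2, h3, h4, h5, ?_⟩
    -- If `C * ‖e‖ * w` were not positive, the average would vanish, contradicting its mixed norm
    -- being at least `θ > 0`. A nonempty class thus forces `C`, `w` and `d` to be positive.
    by_contra hcon
    have hz : g e = fun _ => 0 := funext fun z => norm_le_zero_iff.1 ((hgle e z).trans (by linarith))
    change ENNReal.ofReal θ ≤ mixedNorm p q _ _ (g e) at h5
    rw [hz, mixedNorm_zero hp0 hq0, nonpos_iff_eq_zero, ENNReal.ofReal_eq_zero] at h5
    linarith
  obtain ⟨f₀, hf₀⟩ := hne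
  obtain ⟨e₀, -, -, -, -, -, hpos₀⟩ := hrep f₀ hf₀ _ rfl
  have hC0' : 0 < C := hC0.lt_of_ne fun h => by simp [← h] at hpos₀
  have hw0' : 0 < w := hw0.lt_of_ne fun h => by simp [← h] at hpos₀
  have he₀ : e₀ ≠ 0 := fun h => by simp [h] at hpos₀
  have hd1 : 1 ≤ d := by
    have : Nontrivial (Fin r × R → ℂ) := nontrivial_of_ne e₀ 0 he₀
    rw [hdim]
    exact Module.finrank_pos
  have hζ : 0 < θ / α := by positivity
  set N := deviationLevel p q C₁ M₁ M₂ C w a₁ γ (θ / α) with hNdef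
  have hN : 0 < N := deviationLevel_pos hC₁ hM₁0 hM₂0 hC0' hw0' ha₁ hγ₀ hζ
  have hb : 0 < C / a₁ := by positivity
  have hL : 0 < C / a₁ * w := by positivity
  have hr₁ := rate₁_eq (p := p) (q := q) (C₁ := C₁) (γ := γ) hM₁0 hM₂0 hC0' hw0' ha₁ hζ
    (x := N / (C / a₁ * w)) rfl (by positivity)
  have hr₂ := rate₂_eq (p := p) (q := q) (C₁ := C₁) (γ := γ) hM₁0 hM₂0 hC0' hw0' ha₁ hζ
    (y := N / w) rfl (by positivity)
  rw [sampleThreshold_eq hθ hα hw0' d (y := N / w) rfl (by positivity)] at hnm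
  have hnm0 : (0 : ℝ) < n * m := lt_of_le_of_lt (by positivity) hnm
  have hn0 : 0 < n := Nat.pos_of_ne_zero fun h => by simp [h] at hnm0
  have hm0 : 0 < m := Nat.pos_of_ne_zero fun h => by simp [h] at hnm0
  rw [div_lt_iff₀ (by positivity)] at hnm
  obtain ⟨hu, hbound⟩ := chaining_bound_le hd1 hb hnm0 hN hw0' hnm
  set Q := (haarRect μ₁ μ₂ K₁ K₂).withDensity fun z => ENNReal.ofReal (ρ z) with hQ
  have hQprob : IsProbabilityMeasure Q := by
    rw [← (hX_law 0 0).map_eq]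
    exact Measure.isProbabilityMeasure_map (hX_law 0 0).aemeasurable
  set s := Finset.range n ×ˢ Finset.range m with hs
  have hcard : (s.card : ℝ) = n * m := by simp [hs]
  -- The factor `a₁⁻¹` is chosen so that, by stability, a function of norm at most one corresponds
  -- to a point of the unit ball. The Lipschitz constant becomes `C / a₁ * w`.
  let G : (Fin r × R → ℂ) → G₁ × G₂ → ℝ := fun e z => ‖g (a₁⁻¹ • e) z‖
  have hGm : ∀ e, Measurable (G e) := fun e => (hgm _).norm
  have hGL : ∀ e e' z, |G e z - G e' z| ≤ C / a₁ * w * ‖e - e'‖ := fun e e' z => by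
    refine (abs_norm_sub_norm_le _ _).trans ?_
    have h1 : g (a₁⁻¹ • e) z - g (a₁⁻¹ • e') z = g (a₁⁻¹ • (e - e')) z := by
      have h2 := hglin (a₁⁻¹ • e) (a₁⁻¹ • e') (-1) z
      rw [neg_one_smul, ← sub_eq_add_neg, ← smul_sub] at h2
      rw [h2]
      push_cast
      ring
    rw [h1]
    refine (hgle _ z).trans_eq ?_
    rw [norm_smul, Real.norm_of_nonneg (inv_nonneg.2 ha₁.le)]
    ring
  have hprob := measureReal_uniform_deviation_le (P := P) (Q := Q)
    (X := fun jk : ℕ × ℕ => X jk.1 jk.2) (fun jk => hX_law jk.1 jk.2) hX_indep s hGm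
    (fun z => by simp [G, hg0]) (fun e z => norm_nonneg _) hL hGL hN
    (by rw [Finset.card_product, Finset.card_range, Finset.card_range]; positivity)
    (κ := min (1 / (C / a₁)) 4) (by positivity) (min_le_right _ _) (hdim ▸ hd1)
    (by rw [← hdim, hcard]; exact hu)
  rw [← hdim, hcard] at hprob
  set bad₁ := {η | ∃ e : Fin r × R → ℂ, ‖e‖ ≤ 1 ∧ n * m * N
    < |empiricalDeviation Q (fun jk : ℕ × ℕ => X jk.1 jk.2) s (G e) η|} with hbad₁
  set bad₂ := {η | ∃ jk : ℕ × ℕ, X jk.1 jk.2 η ∉ K₁ ×ˢ K₂} with hbad₂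
  have hKm : MeasurableSet (K₁ ×ˢ K₂) := hK₁.isClosed.measurableSet.prod hK₂.isClosed.measurableSet
  have hbad₂0 : P bad₂ = 0 := by
    have h1 : ∀ jk : ℕ × ℕ, ∀ᵐ η ∂P, X jk.1 jk.2 η ∈ K₁ ×ˢ K₂ := fun jk => by
      have h2 : ∀ᵐ z ∂Q, z ∈ K₁ ×ˢ K₂ :=
        (withDensity_absolutelyContinuous _ _).ae_le (ae_haarRect_mem hK₁ hK₂)
      rw [← (hX_law jk.1 jk.2).map_eq] at h2
      exact ae_of_ae_map (hX_law jk.1 jk.2).aemeasurable h2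
    have h3 := ae_all_iff.2 h1
    rw [ae_iff] at h3
    simpa only [not_forall] using h3
  -- The set `bad₁` is an uncountable union over `e`, so a measurable hull of the same measure
  -- replaces it. The null set `bad₂` is removed because `g e` agrees with `f * ω` only on `K`.
  refine ⟨(toMeasurable P (bad₁ ∪ bad₂))ᶜ, (measurableSet_toMeasurable _ _).compl, ?_, ?_⟩
  · rw [probReal_compl_eq_one_sub (measurableSet_toMeasurable _ _), sub_sub]
    refine sub_le_sub_left ?_ _
    have h1 : P.real (toMeasurable P (bad₁ ∪ bad₂)) = P.real (bad₁ ∪ bad₂) := by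
      simp only [Measure.real, measure_toMeasurable]
    have h2 : P.real bad₂ = 0 := by simp [Measure.real, hbad₂0]
    rw [h1, hr₁, hr₂, prefactor₁, prefactor₂, mul_div_assoc 8, mul_div_assoc 4]
    refine (measureReal_union_le _ _).trans ?_
    rw [h2, add_zero]
    exact hprob.trans hbound
  intro η hη f hf
  have hη' : η ∉ bad₁ ∪ bad₂ := fun h => hη (subset_toMeasurable _ _ h)
  rw [Set.mem_union, not_or] at hη'
  obtain ⟨hη₁, hη₂⟩ := hη'
  have hXK : ∀ j k, X j k η ∈ K₁ ×ˢ K₂ := fun j k => by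
    by_contra h
    exact hη₂ ⟨(j, k), h⟩
  set A := (mixedNorm p q (μ₁.restrict (K₁ - W₁)) (μ₂.restrict (K₂ - W₂)) f).toReal with hA
  obtain ⟨e, hFe, heA, hAα, hconv, hθe, hepos⟩ := hrep f hf A hA
  have he0 : 0 < ‖e‖ := (norm_nonneg e).lt_of_ne fun h => by simp [← h] at hepos
  have hA0 : 0 < A := lt_of_lt_of_le (by positivity) heA
  have hgA : ∀ z, ‖g e z‖ ≤ C / a₁ * w * A := fun z => (hgle e z).trans (by
    have h1 : ‖e‖ ≤ A / a₁ := by rwa [le_div_iff₀ ha₁, mul_comm]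
    calc C * ‖e‖ * w ≤ C * (A / a₁) * w := by gcongr
      _ = _ := by ring)
  have hgi : ∀ (ν : Measure (G₁ × G₂)) [IsFiniteMeasure ν], Integrable (g e) ν := fun ν _ =>
    Integrable.of_bound (hgm e).aestronglyMeasurable _ (ae_of_all _ hgA)
  set J := ∫ z, ‖g e z‖ ∂Q with hJ
  set J₀ := ∫ z, ‖g e z‖ ∂(haarRect μ₁ μ₂ K₁ K₂) with hJ₀
  have hJ₀0 : 0 ≤ J₀ := integral_nonneg fun _ => norm_nonneg _
  have hJ0 : 0 ≤ J := integral_nonneg fun _ => norm_nonneg _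
  have hJ' : ENNReal.ofReal J = ∫⁻ z, ‖g e z‖ₑ ∂Q :=
    ofReal_integral_norm_eq_lintegral_enorm (hgi Q)
  have hJ₀' : ENNReal.ofReal J₀ = ∫⁻ z, ‖g e z‖ₑ ∂(haarRect μ₁ μ₂ K₁ K₂) :=
    ofReal_integral_norm_eq_lintegral_enorm (hgi _)
  have hJ'' : ENNReal.ofReal J
      = ∫⁻ z, ENNReal.ofReal (ρ z) * ‖g e z‖ₑ ∂(haarRect μ₁ μ₂ K₁ K₂) := by
    rw [hJ', hQ, lintegral_withDensity_eq_lintegral_mul₀ hρ_meas.ennreal_ofReal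
      (hgm e).enorm.aemeasurable]
    rfl
  have hKne : (K₁ ×ˢ K₂).Nonempty := ⟨_, hXK 0 0⟩
  have hC₂ : 0 ≤ C₂ := by
    obtain ⟨z, hz⟩ := hKne
    linarith [(hρ_bound z hz).1, (hρ_bound z hz).2]
  have hlow : C₁ * J₀ ≤ J := by
    rw [← ENNReal.ofReal_le_ofReal_iff hJ0, ENNReal.ofReal_mul hC₁.le, hJ₀', hJ'',
      ← lintegral_const_mul _ (hgm e).enorm]
    refine lintegral_mono_ae ?_
    filter_upwards [ae_haarRect_mem hK₁ hK₂] with z hz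
    gcongr
    exact (hρ_bound z hz).1
  have hup : J ≤ C₂ * J₀ := by
    rw [← ENNReal.ofReal_le_ofReal_iff (by positivity), ENNReal.ofReal_mul hC₂, hJ₀', hJ'',
      ← lintegral_const_mul _ (hgm e).enorm]
    refine lintegral_mono_ae ?_
    filter_upwards [ae_haarRect_mem hK₁ hK₂] with z hz
    gcongr
    exact (hρ_bound z hz).2
  have hI₁ : θ ^ (p * q) ≤ M₁ ^ (q - 1) * M₂ ^ (p - 1) * (C / a₁ * w * A) ^ (p * q - 1) * J₀ := by
    have h1 := mixedNorm_rpow_le_lintegral (μ := μ₁.restrict K₁) (ν := μ₂.restrict K₂) hp hq (hgm e)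
      (L := ENNReal.ofReal (C / a₁ * w * A)) fun z => by
        rw [← ofReal_norm]; exact ENNReal.ofReal_le_ofReal (hgA z)
    rw [← lintegral_prod (fun z => ‖g e z‖ₑ) (hgm e).enorm.aemeasurable, ← haarRect, ← hJ₀',
      Measure.restrict_apply_univ, Measure.restrict_apply_univ, ← hM₁', ← hM₂',
      ENNReal.ofReal_rpow_of_pos hM₁0, ENNReal.ofReal_rpow_of_pos hM₂0,
      ENNReal.ofReal_rpow_of_pos (by positivity), ← ENNReal.ofReal_mul (by positivity),
      ← ENNReal.ofReal_mul (by positivity), ← ENNReal.ofReal_mul (by positivity)] at h1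
    have h2 := (ENNReal.rpow_le_rpow hθe (by positivity : 0 ≤ p * q)).trans h1
    rwa [ENNReal.ofReal_rpow_of_pos hθ, ENNReal.ofReal_le_ofReal_iff (by positivity)] at h2
  have hI₂ : J₀ ≤ M₁ ^ ((p - 1) / p) * M₂ ^ ((q - 1) / q) * w * A := by
    have h1 : ENNReal.ofReal J₀ ≤ ∫⁻ z, ‖conv μ₁ μ₂ (shiftCombination φ x y R e) ω z‖ₑ
        ∂(haarRect μ₁ μ₂ K₁ K₂) := by
      rw [hJ₀']
      refine lintegral_mono_ae ?_
      filter_upwards [ae_haarRect_mem hK₁ hK₂] with z hz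
      simp only [g, localAverage, Set.indicator_of_mem hz, le_refl]
    have h2 := h1.trans (lintegral_conv_le hp hq hK₁ hK₂ hW₁ hW₂ hω_supp hω_int
      (continuous_shiftCombination hφ_cont e) (hasCompactSupport_shiftCombination hφ_supp e))
    rwa [hFe, ← hw, ← hM₁', ← hM₂', ENNReal.ofReal_rpow_of_pos hM₁0,
      ENNReal.ofReal_rpow_of_pos hM₂0, ← ENNReal.ofReal_mul (by positivity),
      ← ENNReal.ofReal_mul (by positivity), ← ENNReal.ofReal_mul (by positivity),
      ENNReal.ofReal_le_ofReal_iff (by positivity)] at h2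
  set c : Fin n → Fin m → ℂ := fun j k => conv μ₁ μ₂ f ω (X j k η) with hc
  set S : ℝ := ∑ j, ∑ k, ‖c j k‖ with hSdef
  have hS' : ENNReal.ofReal S = ∑ j, ∑ k, ‖c j k‖ₑ := by
    rw [hSdef, ENNReal.ofReal_sum_of_nonneg fun j _ => Finset.sum_nonneg fun k _ => norm_nonneg _]
    refine Finset.sum_congr rfl fun j _ => ?_
    rw [ENNReal.ofReal_sum_of_nonneg fun k _ => norm_nonneg _]
    simp only [ofReal_norm]
  have hS0 : 0 ≤ S := Finset.sum_nonneg fun j _ => Finset.sum_nonneg fun k _ => norm_nonneg _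
  have hσ_le : seqNorm p q c ≤ ENNReal.ofReal S := by
    rw [hS']
    simpa only [tsum_fintype] using seqNorm_le_tsum hp hq c
  have hσ_fin : seqNorm p q c ≠ ∞ := ne_top_of_le_ne_top ENNReal.ofReal_ne_top hσ_le
  have hσ₁ : (seqNorm p q c).toReal ≤ S := ENNReal.toReal_le_of_le_ofReal hS0 hσ_le
  have hσ₂ : S ≤ (n : ℝ) ^ ((p - 1) / p) * (m : ℝ) ^ ((q - 1) / q) * (seqNorm p q c).toReal := by
    have h1 := sum_enorm_le_seqNorm hp hq c
    have hn' : (0 : ℝ) < n := by exact_mod_cast hn0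
    have hm' : (0 : ℝ) < m := by exact_mod_cast hm0
    rwa [← hS', ← ENNReal.ofReal_toReal hσ_fin, ← ENNReal.ofReal_natCast n,
      ← ENNReal.ofReal_natCast m, ENNReal.ofReal_rpow_of_pos hn', ENNReal.ofReal_rpow_of_pos hm',
      ← ENNReal.ofReal_mul (by positivity), ← ENNReal.ofReal_mul (by positivity),
      ENNReal.ofReal_le_ofReal_iff (by positivity)] at h1
  -- The uniform bound is applied at `(a₁ / A) • e`, which lies in the unit ball and at which `G`
  -- equals `A⁻¹ * ‖g e‖`; multiplying by `A` gives the bound for `f`.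
  have hdevS : |S - n * m * J| ≤ n * m * (A * N) := by
    have hGe : ∀ z, G ((a₁ / A) • e) z = A⁻¹ * ‖g e z‖ := fun z => by
      have h1 : a₁⁻¹ • (a₁ / A) • e = A⁻¹ • e := by
        rw [smul_smul]; congr 1; field_simp
      simp only [G]
      rw [h1, hgsmul, norm_mul, Complex.norm_real, Real.norm_of_nonneg (inv_nonneg.2 hA0.le)]
    have h2 : ‖(a₁ / A) • e‖ ≤ 1 := by
      rw [norm_smul, Real.norm_of_nonneg (by positivity), div_mul_eq_mul_div, div_le_one hA0]
      exact heA
    have h3 : |empiricalDeviation Q (fun jk : ℕ × ℕ => X jk.1 jk.2) s (G ((a₁ / A) • e)) η|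
        ≤ n * m * N := by
      by_contra h
      exact hη₁ ⟨_, h2, not_le.1 h⟩
    have h4 : empiricalDeviation Q (fun jk : ℕ × ℕ => X jk.1 jk.2) s (G ((a₁ / A) • e)) η
        = A⁻¹ * (S - n * m * J) := by
      rw [empiricalDeviation, Finset.sum_sub_distrib, Finset.sum_const, nsmul_eq_mul, hcard]
      simp only [hGe]
      rw [integral_const_mul, ← Finset.mul_sum, hs, Finset.sum_product]
      have h5 : ∑ j ∈ Finset.range n, ∑ k ∈ Finset.range m, ‖g e (X j k η)‖ = S := by
        rw [hSdef, Finset.sum_range]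
        refine Finset.sum_congr rfl fun j _ => ?_
        rw [Finset.sum_range]
        exact Finset.sum_congr rfl fun k _ => by rw [hc]; simp only [hconv _ (hXK _ _)]
      rw [h5]
      ring
    rw [h4, abs_mul, abs_of_pos (inv_pos.2 hA0), inv_mul_le_iff₀ hA0] at h3
    linarith
  rw [abs_le] at hdevS
  exact ⟨lowerBound_mul_le hC₁ hM₁0 hM₂0 hC0' hw0' ha₁ hθ hA0 hAα hp hq hn0 hm0 hI₁ hlow
      (by rw [← hNdef]; linarith) hσ₂,
    le_upperBound_mul hup hI₂ hC₂ (by rw [← hNdef]; linarith) hσ₁⟩
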